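/- Let $G$ be a finite group and let $g',d\in\mathbb N$. Write $[x,y]=xyx^{-1}y^{-1}$. **Hurwitz generating systems.** For a group $H$ and $v=(c_1,\dots,c_d;a_1,b_1,\dots,a_{g'},b_{g'})\in H^{d+2g'}$ put $ev(v)=\prod_{j=1}^d c_j\cdot\prod_{i=1}^{g'}[a_i,b_i]\in H$. Let $HS(G;g',d)$ be the set of all $v\in G^{d+2g'}$ such that $c_i\neq 1$ for all $i$, the entries of $v$ generate $G$, and $ev(v)=1$. The group $\mathrm{Aut}(G)$ acts on $HS(G;g',d)$ componentwise. **The groups $G_\Sigma$.** Let $F$ be the free group on the symbols $\hat g$, $g\in G$, and let $R$ be the kernel of $F\to G$, $\hat g\mapsto g$. For a (possibly empty) union $\Sigma\subset G$ of non-trivial conjugacy classes let $R_\Sigma$ be the normal subgroup of $F$ generated by $[F,R]$ and by all $\hat a\hat b\hat c^{-1}\hat b^{-1}$ with $a\in\Sigma$, $b,c\in G$, $ab=bc$. Put $G_\Sigma=F/R_\Sigma$ and $G^\cup=\coprod_\Sigma G_\Sigma$. The group $\mathrm{Aut}(G)$ acts on $G^\cup$ by the isomorphisms $f_\Sigma\colon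 G_\Sigma\to G_{f(\Sigma)}$, $\hat a\mapsto\widehat{f(a)}$. **The map $\tilde\varepsilon$.** For $v\in HS(G;g',d)$ let $\Sigma_v$ be the union of the conjugacy classes of $c_1,\dots,c_d$, and let $\varepsilon(v)=\prod_{j=1}^d\widehat{c_j}\cdot\prod_{i=1}^{g'}[\widehat{a_i},\widehat{b_i}]\in G_{\Sigma_v}\subset G^\cup$ be the evaluation of the tautological lift of $v$. The map $\varepsilon$ is $\mathrm{Aut}(G)$-equivariant and so induces a map $\tilde\varepsilon\colon HS(G;g',d)/\mathrm{Aut}(G)\to G^\cup/\mathrm{Aut}(G)$. **The mapping class group.** Let $C'$ be a compact connected Riemann surface of genus $g'$, let $\mathcal B=\{y_1,\dots,y_d\}\subset C'$ consist of $d$ points, and let $y_0\in C'\setminus\mathcal B$. Let $Map(g',d)=Diff^+(C',\mathcal B)/Diff^0(C',\mathcal B)$ be the group of orientation preserving diffeomorphisms of $C'$ that map the set $\mathcal B$ onto itself, modulo those isotopic to the identity through such diffeomorphisms. Fix a geometric basis $\gamma_1,\dots,\gamma_d;\alpha_1,\beta_1,\dots,\alpha_{g'},\beta_{g'}$ of $\pi_1(C'\setminus\mathcal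 B,y_0)$. Here $\gamma_i$ is a positive loop around $y_i$, and $\pi_1(C'\setminus\mathcal B,y_0)$ is presented by these generators and the single relation $\prod_j\gamma_j\cdot\prod_i[\alpha_i,\beta_i]=1$. The loops cut $C'$ into discs around the points $y_i$ and a polygon. For a point $p$ inside this polygon they freely generate $\pi_1(C'\setminus(\mathcal B\cup\{p\}),y_0)$, and there $\prod_j\gamma_j\cdot\prod_i[\alpha_i,\beta_i]$ is a loop once around $p$, in one of the two directions. By means of this basis, $v\in HS(G;g',d)$ corresponds to the homomorphism $\mu_v\colon\pi_1(C'\setminus\mathcal B,y_0)\to G$ with values $c_i,a_j,b_j$ on $\gamma_i,\alpha_j,\beta_j$. The group $Map(g',d)$ acts on $HS(G;g',d)/\mathrm{Aut}(G)$ by $[f]\cdot[\mu]=[\mu\circ f_*^{-1}]$, where $f_*$ is well defined up to inner automorphisms. **Proposition.** The map $\tilde\varepsilon$ is constant on the orbits of $Map(g',d)$, that is, $\tilde\varepsilon(\varphi\cdot x)=\tilde\varepsilon(x)$ for all $\varphi\in Map(g',d)$ and $x\in HS(G;g',d)/\mathrm{Aut}(G)$. Hence there is a unique map $$\hat\varepsilon\colon\bigl(HS(G;g',d)/\mathrm{Aut}(G)\bigr)/Map(g',d)\longrightarrow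 G^\cup/\mathrm{Aut}(G)$$ that takes the class of each $x\in HS(G;g',d)/\mathrm{Aut}(G)$ to $\tilde\varepsilon(x)$. -/

import Mathlib

open scoped Manifold ContDiff

noncomputable section

namespace Hurwitz

/-! ### Hurwitz vectors -/

/-- Positions of the entries of a `(g', d)`-Hurwitz vector
`(c₁, …, c_d ; a₁, b₁, …, a_{g'}, b_{g'})`: `inl i` is the position of `cᵢ`, `inr (inl j)` that of
`aⱼ` and `inr (inr j)` that of `bⱼ`. -/
abbrev Index (g' d : ℕ) : Type := Fin d ⊕ (Fin g' ⊕ Fin g')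

/-- A `(g', d)`-Hurwitz vector in a group `H`, an element of `H^(d + 2g')`. -/
abbrev HurwitzVector (g' d : ℕ) (H : Type*) : Type _ := Index g' d → H

/-- The commutator `[x, y] = x y x⁻¹ y⁻¹`. -/
def comm {H : Type*} [Group H] (x y : H) : H := x * y * x⁻¹ * y⁻¹

theorem map_comm {H K : Type*} [Group H] [Group K] (φ : H →* K) (x y : H) :
    φ (comm x y) = comm (φ x) (φ y) := by
  simp [comm]

/-- The evaluation `∏ⱼ cⱼ · ∏ᵢ [aᵢ, bᵢ]` (ordered products). -/
def ev {g' d : ℕ} {H : Type*} [Group H] (v : HurwitzVector g' d H) : H :=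
  (List.ofFn fun i : Fin d => v (Sum.inl i)).prod *
    (List.ofFn fun j : Fin g' => comm (v (Sum.inr (Sum.inl j))) (v (Sum.inr (Sum.inr j)))).prod

theorem map_ev {g' d : ℕ} {H K : Type*} [Group H] [Group K] (φ : H →* K)
    (v : HurwitzVector g' d H) : φ (ev v) = ev fun k => φ (v k) := by
  simp [ev, map_list_prod, List.map_ofFn, Function.comp_def, map_comm]

/-- The set `HS(G; g', d)` of Hurwitz generating systems of length `d + 2g'` in `G`. -/
structure HS (G : Type*) [Group G] (g' d : ℕ) where
  /-- the underlying Hurwitz vector -/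
  vec : HurwitzVector g' d G
  ne_one : ∀ i : Fin d, vec (Sum.inl i) ≠ 1
  generates : Subgroup.closure (Set.range vec) = ⊤
  ev_eq_one : ev vec = 1

section Groups

variable {G : Type*} [Group G]

@[ext] theorem HS.ext {g' d : ℕ} {v w : HS G g' d} (h : v.vec = w.vec) : v = w := by
  cases v; cases w; cases h; rfl

/-- `Aut(G)` acts componentwise on `HS(G; g', d)`. -/
instance HS.mulAction (g' d : ℕ) : MulAction (MulAut G) (HS G g' d) where
  smul f v :=
    { vec := fun k => f (v.vec k)
      ne_one := fun i h => v.ne_one i (by simpa using h)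
      generates := by
        have h : Set.range (fun k => f (v.vec k)) = f.toMonoidHom '' Set.range v.vec := by
          rw [← Set.range_comp]; rfl
        rw [h, ← MonoidHom.map_closure, v.generates]
        exact Subgroup.map_top_of_surjective _ f.surjective
      ev_eq_one := by
        have h := map_ev f.toMonoidHom v.vec
        rw [v.ev_eq_one, map_one] at h
        exact h.symm }
  one_smul _ := rfl
  mul_smul _ _ _ := rfl

variable (G) in
/-- `HS(G; g', d) / Aut(G)`. -/
abbrev HSModAut (g' d : ℕ) : Type _ := MulAction.orbitRel.Quotient (MulAut G) (HS G g' d)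

/-! ### The groups `G_Σ` and their disjoint union `G^∪` -/

variable (G) in
/-- A union `Σ` of non-trivial conjugacy classes of `G` (possibly empty). -/
@[ext] structure ConjUnion where
  /-- the underlying subset of `G` -/
  carrier : Set G
  one_notMem : (1 : G) ∉ carrier
  conj_mem : ∀ a ∈ carrier, ∀ b : G, b * a * b⁻¹ ∈ carrier

/-- `Aut(G)` acts on the unions of non-trivial conjugacy classes by taking images. -/
instance ConjUnion.mulAction : MulAction (MulAut G) (ConjUnion G) where
  smul f S :=
    { carrier := f '' S.carrier
      one_notMem := by
        rintro ⟨a, ha, h⟩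
        have : a = 1 := by simpa using h
        exact S.one_notMem (this ▸ ha)
      conj_mem := by
        rintro _ ⟨a, ha, rfl⟩ b
        exact ⟨f.symm b * a * (f.symm b)⁻¹, S.conj_mem a ha _, by simp⟩ }
  one_smul S := ConjUnion.ext (Set.image_id _)
  mul_smul f h S := ConjUnion.ext (Set.image_comp f h S.carrier)

theorem ConjUnion.smul_carrier (f : MulAut G) (S : ConjUnion G) :
    (f • S).carrier = f '' S.carrier := rfl

variable (G) in
/-- `R`, the kernel of the map `F → G`, `ĝ ↦ g`, where `F` is the free group on the set `G`. -/
def relators : Subgroup (FreeGroup G) := (FreeGroup.lift (id : G → G)).ker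

/-- The normal generators of `R_Σ`: the elements of `[F, R]` and the elements
`â b̂ ĉ⁻¹ b̂⁻¹` with `a ∈ Σ` and `a b = b c`. -/
def relatorSet (S : ConjUnion G) : Set (FreeGroup G) :=
  {w | ∃ x : FreeGroup G, ∃ r ∈ relators G, w = comm x r} ∪
  {w | ∃ a b c : G, a ∈ S.carrier ∧ a * b = b * c ∧
    w = FreeGroup.of a * FreeGroup.of b * (FreeGroup.of c)⁻¹ * (FreeGroup.of b)⁻¹}

/-- `R_Σ`. -/
def RSigma (S : ConjUnion G) : Subgroup (FreeGroup G) := Subgroup.normalClosure (relatorSet S)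

instance (S : ConjUnion G) : (RSigma S).Normal := Subgroup.normalClosure_normal

/-- `G_Σ = F / R_Σ`. -/
abbrev GSigma (S : ConjUnion G) : Type _ := FreeGroup G ⧸ RSigma S

/-- The tautological section `G → G_Σ`, `a ↦ â`. -/
def hat (S : ConjUnion G) (a : G) : GSigma S := QuotientGroup.mk (FreeGroup.of a)

theorem relators_map (f : MulAut G) {r : FreeGroup G} (hr : r ∈ relators G) :
    FreeGroup.map f r ∈ relators G := by
  have h : (FreeGroup.lift (id : G → G)).comp (FreeGroup.map f)
      = f.toMonoidHom.comp (FreeGroup.lift (id : G → G)) := by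
    ext a; simp
  have h2 := DFunLike.congr_fun h r
  have h3 : FreeGroup.lift (id : G → G) r = 1 := hr
  simp only [MonoidHom.comp_apply, h3, map_one] at h2
  exact h2

theorem RSigma_le_comap (f : MulAut G) (S : ConjUnion G) :
    RSigma S ≤ (RSigma (f • S)).comap (FreeGroup.map f) := by
  refine Subgroup.normalClosure_le_normal ?_
  rintro w (⟨x, r, hr, rfl⟩ | ⟨a, b, c, ha, h, rfl⟩)
  · refine Subgroup.subset_normalClosure (Or.inl ⟨FreeGroup.map f x, _, relators_map f hr, ?_⟩)
    exact map_comm _ _ _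
  · refine Subgroup.subset_normalClosure (Or.inr ⟨f a, f b, f c, ⟨a, ha, rfl⟩, ?_, ?_⟩)
    · rw [← map_mul, h, map_mul]
    · simp

/-- The map `f_Σ : G_Σ → G_{f(Σ)}` induced by `f ∈ Aut(G)`, which sends `â` to `f(a)^`. -/
def autMap (f : MulAut G) (S : ConjUnion G) : GSigma S →* GSigma (f • S) :=
  QuotientGroup.map _ _ (FreeGroup.map f) (RSigma_le_comap f S)

theorem autMap_hat (f : MulAut G) (S : ConjUnion G) (a : G) :
    autMap f S (hat S a) = hat (f • S) (f a) := by
  simp [autMap, hat]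

variable (G) in
/-- `G^∪`, the disjoint union of all the groups `G_Σ`. -/
abbrev GUnion : Type _ := Σ S : ConjUnion G, GSigma S

theorem GUnion.mk_eq {S T : ConjUnion G} (h : S = T) {w w' : FreeGroup G} (hw : w = w') :
    (⟨S, QuotientGroup.mk w⟩ : GUnion G) = ⟨T, QuotientGroup.mk w'⟩ := by
  subst h; subst hw; rfl

/-- `Aut(G)` acts on `G^∪` through the maps `f_Σ`. -/
instance GUnion.mulAction : MulAction (MulAut G) (GUnion G) where
  smul f ξ := ⟨f • ξ.1, autMap f ξ.1 ξ.2⟩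
  one_smul := by
    rintro ⟨S, ξ⟩
    induction ξ using QuotientGroup.induction_on with
    | H w =>
      refine GUnion.mk_eq (one_smul _ S) ?_
      exact FreeGroup.map.id w
  mul_smul := by
    rintro f h ⟨S, ξ⟩
    induction ξ using QuotientGroup.induction_on with
    | H w =>
      refine GUnion.mk_eq (mul_smul f h S) ?_
      exact (FreeGroup.map.comp (f := h) (g := f) w).symm

variable (G) in
/-- `G^∪ / Aut(G)`. -/
abbrev GUnionModAut : Type _ := MulAction.orbitRel.Quotient (MulAut G) (GUnion G)

/-! ### The tautological lift and the maps `ε` and `ε̃` -/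

/-- `Σ_v`, the union of the conjugacy classes of `c₁, …, c_d`. -/
def HS.sigma {g' d : ℕ} (v : HS G g' d) : ConjUnion G where
  carrier := {a | ∃ i : Fin d, IsConj (v.vec (Sum.inl i)) a}
  one_notMem := by
    rintro ⟨i, hi⟩
    exact v.ne_one i (isConj_one_right.mp hi.symm)
  conj_mem := by
    rintro a ⟨i, hi⟩ b
    exact ⟨i, hi.trans (isConj_iff.mpr ⟨b, rfl⟩)⟩

/-- The tautological lift `v̂` of `v`, a Hurwitz vector in `G_{Σ_v}`. -/
def HS.tautLift {g' d : ℕ} (v : HS G g' d) : HurwitzVector g' d (GSigma v.sigma) :=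
  fun k => hat v.sigma (v.vec k)

/-- `ε(v) ∈ G_{Σ_v} ⊆ G^∪`, the evaluation of the tautological lift of `v`. -/
def epsilon {g' d : ℕ} (v : HS G g' d) : GUnion G := ⟨v.sigma, ev v.tautLift⟩

theorem HS.sigma_smul {g' d : ℕ} (f : MulAut G) (v : HS G g' d) :
    (f • v).sigma = f • v.sigma := by
  refine ConjUnion.ext (Set.ext fun a => ⟨?_, ?_⟩)
  · rintro ⟨i, hi⟩
    refine ⟨f.symm a, ⟨i, ?_⟩, f.apply_symm_apply a⟩
    have h := f.symm.toMonoidHom.map_isConj hi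
    have e : f.symm.toMonoidHom ((f • v).vec (Sum.inl i)) = v.vec (Sum.inl i) :=
      f.symm_apply_apply _
    rw [e] at h
    exact h
  · rintro ⟨a, ⟨i, hi⟩, rfl⟩
    exact ⟨i, f.toMonoidHom.map_isConj hi⟩

theorem epsilon_smul {g' d : ℕ} (f : MulAut G) (v : HS G g' d) :
    epsilon (f • v) = f • epsilon v := by
  have key : ∀ T : ConjUnion G, T = f • v.sigma →
      (⟨T, ev fun k => hat T (f (v.vec k))⟩ : GUnion G) = f • epsilon v := by
    rintro _ rfl
    have h := map_ev (autMap f v.sigma) v.tautLift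
    simp only [HS.tautLift, autMap_hat] at h
    exact congrArg (Sigma.mk (f • v.sigma)) h.symm
  exact key _ (HS.sigma_smul f v)

/-- `ε̃ : HS(G; g', d)/Aut(G) → G^∪/Aut(G)`, the map induced by `ε`. -/
def epsilonTilde {g' d : ℕ} : HSModAut G g' d → GUnionModAut G :=
  Quotient.map' epsilon (by
    rintro v w ⟨f, hf⟩
    exact ⟨f, by
      have hf' : f • w = v := hf
      rw [← hf']
      exact (epsilon_smul f w).symm⟩)

end Groups

/-! ### Surfaces, mapping classes and geometric bases

The surface `C'` is a compact connected Riemann surface `C`, with its orientation given by the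
complex structure. The underlying real smooth surface is modelled on `𝓘(ℝ, ℂ)`. -/

section Surface

variable {C : Type*} [TopologicalSpace C]

/-- The complement `C ∖ B`. -/
abbrev Punctured (B : Set C) : Type _ := {x : C // x ∉ B}

variable [ChartedSpace ℂ C]

/-- The Jacobian determinant of `f` at `x`, in the charts of `C` chosen at `x` and at `f x`. Charts
of a Riemann surface change by maps with positive Jacobian, hence the sign is independent of the
choice of charts. -/
def jacobian (f : C → C) (x : C) : ℝ :=
  let A : ℂ →L[ℝ] ℂ := mfderiv 𝓘(ℝ, ℂ) 𝓘(ℝ, ℂ) f x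
  LinearMap.det (A : ℂ →ₗ[ℝ] ℂ)

theorem jacobian_id (x : C) : jacobian (id : C → C) x = 1 := by
  unfold jacobian
  rw [mfderiv_id]
  exact LinearMap.det_id

theorem jacobian_comp {f h : C → C} (x : C)
    (hh : MDifferentiableAt 𝓘(ℝ, ℂ) 𝓘(ℝ, ℂ) h (f x))
    (hf : MDifferentiableAt 𝓘(ℝ, ℂ) 𝓘(ℝ, ℂ) f x) :
    jacobian (h ∘ f) x = jacobian h (f x) * jacobian f x := by
  unfold jacobian
  rw [mfderiv_comp x hh hf]
  exact LinearMap.det_comp _ _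

/-- `Diff⁺(C, B)`: the group of orientation preserving diffeomorphisms of `C` which map the set
`B` onto itself. -/
def DiffPlus (B : Set C) : Subgroup (C ≃ₜ C) where
  carrier := {f | ContMDiff 𝓘(ℝ, ℂ) 𝓘(ℝ, ℂ) ∞ f ∧ ContMDiff 𝓘(ℝ, ℂ) 𝓘(ℝ, ℂ) ∞ f.symm ∧
    (∀ x, 0 < jacobian f x) ∧ ∀ x, f x ∈ B ↔ x ∈ B}
  one_mem' := ⟨contMDiff_id, contMDiff_id,
    fun x => lt_of_lt_of_eq one_pos (jacobian_id x).symm, fun _ => Iff.rfl⟩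
  mul_mem' := by
    rintro f h ⟨f1, f2, f3, f4⟩ ⟨h1, h2, h3, h4⟩
    refine ⟨f1.comp h1, h2.comp f2, fun x => ?_, fun x => (f4 (h x)).trans (h4 x)⟩
    have e := jacobian_comp (f := h) (h := f) x (f1.mdifferentiable (by simp) _)
      (h1.mdifferentiable (by simp) _)
    exact lt_of_lt_of_eq (mul_pos (f3 _) (h3 _)) e.symm
  inv_mem' := by
    rintro f ⟨f1, f2, f3, f4⟩
    refine ⟨f2, f1, fun x => ?_, fun x => ?_⟩
    · have e := jacobian_comp (f := f.symm) (h := f) x (f1.mdifferentiable (by simp) _)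
        (f2.mdifferentiable (by simp) _)
      have e' : (f : C → C) ∘ f.symm = id := funext f.apply_symm_apply
      rw [e', jacobian_id] at e
      have p := f3 (f.symm x)
      have q : 0 < jacobian f (f.symm x) * jacobian f.symm x := by rw [← e]; exact one_pos
      exact (mul_pos_iff_of_pos_left p).mp q
    · have h := f4 (f.symm x)
      rw [f.apply_symm_apply] at h
      exact h.symm

/-- The map of `C ∖ B` to itself given by `f ∈ Diff⁺(C, B)`. -/
def DiffPlus.punctured {B : Set C} (f : DiffPlus B) : C(Punctured B, Punctured B) where
  toFun x := ⟨(f : C ≃ₜ C) x, fun h => x.2 ((f.2.2.2.2 x).mp h)⟩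
  continuous_toFun :=
    ((f : C ≃ₜ C).continuous.comp continuous_subtype_val).subtype_mk _

section MappingClasses

variable [CompactSpace C] [T2Space C]

/-- `Diff⁰(C, B)`: the diffeomorphisms isotopic to the identity through elements of
`Diff⁺(C, B)`. -/
def DiffZero (B : Set C) : Subgroup (DiffPlus B) where
  carrier := {f | ∃ F : unitInterval → DiffPlus B,
    Continuous (fun p : unitInterval × C => (F p.1 : C ≃ₜ C) p.2) ∧ F 0 = 1 ∧ F 1 = f}
  one_mem' := ⟨fun _ => 1, continuous_snd, rfl, rfl⟩
  mul_mem' := by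
    rintro f h ⟨F, F1, F2, F3⟩ ⟨H, H1, H2, H3⟩
    refine ⟨fun t => F t * H t, ?_, by simp [F2, H2], by simp [F3, H3]⟩
    exact F1.comp (continuous_fst.prodMk H1)
  inv_mem' := by
    rintro f ⟨F, F1, F2, F3⟩
    refine ⟨fun t => (F t)⁻¹, ?_, by simp [F2], by simp [F3]⟩
    let e : unitInterval × C ≃ unitInterval × C :=
      { toFun := fun p => (p.1, (F p.1 : C ≃ₜ C) p.2)
        invFun := fun p => (p.1, (F p.1 : C ≃ₜ C).symm p.2)
        left_inv := fun p => by simp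
        right_inv := fun p => by simp }
    have he : Continuous e := continuous_fst.prodMk F1
    exact continuous_snd.comp he.continuous_symm_of_equiv_compact_to_t2

instance (B : Set C) : (DiffZero B).Normal where
  conj_mem := by
    rintro f ⟨F, F1, F2, F3⟩ h
    refine ⟨fun t => h * F t * h⁻¹, ?_, by simp [F2], by simp [F3]⟩
    exact (h : C ≃ₜ C).continuous.comp
      (F1.comp (continuous_fst.prodMk ((h : C ≃ₜ C).symm.continuous.comp continuous_snd)))

/-- The full mapping class group `Map(g', d) = Diff⁺(C, B) / Diff⁰(C, B)`. -/
abbrev MappingClassGroup (B : Set C) : Type _ := DiffPlus B ⧸ DiffZero B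

end MappingClasses

/-- `x ∈ π₁(C ∖ B, y₀)` is a positive loop around `p ∈ B`: it is the class of a loop that runs
along a path `l` to a point near `p`, once counterclockwise along a circle around `p` (in the chart
chosen at `p`) which bounds a closed disc whose only point in `B` is `p`, and back along `l`. -/
def IsLoopAround {B : Set C} {y₀ : Punctured B} (p : C)
    (x : FundamentalGroup (Punctured B) y₀) : Prop :=
  p ∈ B ∧ ∃ r : ℝ, 0 < r ∧
    Metric.closedBall (chartAt ℂ p p) r ⊆ (chartAt ℂ p).target ∧
    (∀ z ∈ Metric.closedBall (chartAt ℂ p p) r, (chartAt ℂ p).symm z ∈ B → z = chartAt ℂ p p) ∧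
    ∃ (s : Punctured B) (circle : Path s s) (l : Path y₀ s),
      (∀ t : unitInterval, (circle t : C) = (chartAt ℂ p).symm
        (chartAt ℂ p p + r * Complex.exp (2 * Real.pi * Complex.I * (t : ℝ)))) ∧
      x = FundamentalGroup.fromPath
        (Path.Homotopic.Quotient.mk ((l.trans circle).trans l.symm))

/-- The inclusion of `C ∖ (B ∪ {p})` in `C ∖ B`. -/
def fillIn (B : Set C) (p : C) : C(Punctured (insert p B), Punctured B) where
  toFun x := ⟨x.1, fun h => x.2 (Set.mem_insert_of_mem p h)⟩
  continuous_toFun := continuous_subtype_val.subtype_mk _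

/-- A geometric basis `γ₁, …, γ_d ; α₁, β₁, …, α_{g'}, β_{g'}` of `π₁(C ∖ B, y₀)`,
`B = {y₁, …, y_d}`.

Simple loops based at `y₀`, disjoint away from `y₀`, which form such a basis cut `C` into `d` discs,
around the points `yᵢ`, and one polygon. If `p` is a point inside the polygon, then the loops miss
`p`, the space `C ∖ (B ∪ {p})` retracts onto the bouquet of the loops, and the boundary of
the polygon, which spells the word `∏ γⱼ ∏ [αᵢ, βᵢ]`, runs once around `p`. These are the properties
of the loops that are recorded, together with the presentation of `π₁(C ∖ B, y₀)` which results from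
them by filling in `p`; the loops are not required to be simple or disjoint. -/
structure GeometricBasis (g' d : ℕ) (B : Set C) (y₀ : Punctured B) where
  /-- the points `y₁, …, y_d` -/
  pt : Fin d → C
  pt_injective : Function.Injective pt
  range_pt : Set.range pt = B
  /-- a point `p` inside the polygon -/
  centre : C
  centre_notMem : centre ∉ B
  base_notMem : (y₀ : C) ∉ insert centre B
  /-- the classes of the loops in `π₁(C ∖ (B ∪ {p}), y₀)` -/
  loop : HurwitzVector g' d (FundamentalGroup (Punctured (insert centre B)) ⟨y₀, base_notMem⟩)
  around : ∀ i : Fin d, IsLoopAround (pt i) (loop (Sum.inl i))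
  free : Function.Bijective (FreeGroup.lift loop)
  boundary : IsLoopAround centre (ev loop) ∨ IsLoopAround centre (ev loop)⁻¹
  /-- the classes of the loops in `π₁(C ∖ B, y₀)` -/
  gen : HurwitzVector g' d (FundamentalGroup (Punctured B) y₀)
  gen_eq : ∀ k, gen k = FundamentalGroup.map (fillIn B centre) ⟨y₀, base_notMem⟩ (loop k)
  gen_surjective : Function.Surjective (FreeGroup.lift gen)
  gen_ker : (FreeGroup.lift gen).ker = Subgroup.normalClosure {ev FreeGroup.of}

namespace GeometricBasis

variable {g' d : ℕ} {B : Set C} {y₀ : Punctured B} {G : Type*} [Group G]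

/-- The monodromy `μ : π₁(C ∖ B, y₀) → G` which corresponds to `v ∈ HS(G; g', d)`: the
homomorphism with values `cᵢ`, `aⱼ`, `bⱼ` on the geometric basis. -/
def monodromy (b : GeometricBasis g' d B y₀) (v : HS G g' d) :
    FundamentalGroup (Punctured B) y₀ →* G :=
  (FreeGroup.lift b.gen).liftOfSurjective b.gen_surjective ⟨FreeGroup.lift v.vec, by
    rw [b.gen_ker]
    refine Subgroup.normalClosure_le_normal ?_
    rintro _ rfl
    have h := map_ev (FreeGroup.lift v.vec) (FreeGroup.of : Index g' d → _)
    simp only [FreeGroup.lift_apply_of] at h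
    exact h.trans v.ev_eq_one⟩

theorem monodromy_gen (b : GeometricBasis g' d B y₀) (v : HS G g' d) (k : Index g' d) :
    b.monodromy v (b.gen k) = v.vec k := by
  have h := (FreeGroup.lift b.gen).liftOfRightInverse_comp_apply _
    (Function.rightInverse_surjInv b.gen_surjective) ⟨FreeGroup.lift v.vec, by
      rw [b.gen_ker]
      refine Subgroup.normalClosure_le_normal ?_
      rintro _ rfl
      have h := map_ev (FreeGroup.lift v.vec) (FreeGroup.of : Index g' d → _)
      simp only [FreeGroup.lift_apply_of] at h
      exact h.trans v.ev_eq_one⟩ (FreeGroup.of k)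
  simp only [FreeGroup.lift_apply_of] at h
  exact h

/-- `w` is a transform of `v` by `f ∈ Diff⁺(C, B)`: the monodromies satisfy `μ_w ∘ f_* = μ_v`, where
`f_* : π₁(C ∖ B, y₀) → π₁(C ∖ B, f(y₀))` is followed by the identification with `π₁(C ∖ B, y₀)` along
some path from `y₀` to `f(y₀)`. Another path changes `w` by an inner automorphism of `G`. -/
def Transforms (b : GeometricBasis g' d B y₀) (f : DiffPlus B) (v w : HS G g' d) : Prop :=
  ∃ l : Path y₀ (DiffPlus.punctured f y₀), ∀ x : FundamentalGroup (Punctured B) y₀,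
    b.monodromy w ((FundamentalGroup.fundamentalGroupMulEquivOfPath l).symm
      (FundamentalGroup.map (DiffPlus.punctured f) y₀ x)) = b.monodromy v x

variable [CompactSpace C] [T2Space C]

/-- The action of `Map(g', d)` on `HS(G; g', d)/Aut(G)`, given by
`Map(g', d) → Out(π₁(C ∖ B, y₀))` and the correspondence of monodromies with Hurwitz generating
systems: the relation `φ · X = Y`. -/
def Acts (b : GeometricBasis g' d B y₀) (φ : MappingClassGroup B) (X Y : HSModAut G g' d) : Prop :=
  ∃ f : DiffPlus B, QuotientGroup.mk f = φ ∧ ∃ v w : HS G g' d,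
    Quotient.mk _ v = X ∧ Quotient.mk _ w = Y ∧ b.Transforms f v w

variable (G) in
/-- `(HS(G; g', d)/Aut(G)) / Map(g', d)`, the set of unmarked topological types. -/
def UnmarkedTypes (b : GeometricBasis g' d B y₀) : Type _ :=
  Quot fun X Y : HSModAut G g' d => ∃ φ : MappingClassGroup B, b.Acts φ X Y

/-- The class of an element of `HS(G; g', d)/Aut(G)` modulo `Map(g', d)`. -/
def unmarkedType (b : GeometricBasis g' d B y₀) (X : HSModAut G g' d) : b.UnmarkedTypes G :=
  Quot.mk _ X

end GeometricBasis

end Surface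

end Hurwitz

end

/-! The kernel of `G_Σ → G` is central, and conjugation in `G_Σ` takes `ĉ`, for `c ∈ Σ`, to the
tautological lift of the conjugate of `c` in `G` (`GSigma.conj_hat`). So any lift of a Hurwitz
vector whose `c`-entries are conjugates of such `ĉ` has the same evaluation as the tautological
lift; the choice of the other entries cancels in the commutators.

Let `μ_w ∘ f_* = μ_v`. Since `f` preserves orientation, `f_*` takes each `γᵢ` to a conjugate of some
`γ_σ(i)`, not of its inverse (`exists_represents_map`): on a small circle `f` is close to `u ↦ α u`
with `α ≠ 0`, up to a homotopy in the punctured disc. Lift `f_*` to an endomorphism `Θ` of the free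
group on the basis, with the same property, and let `r` be the word `∏ γⱼ ∏ [αᵢ, βᵢ]`. Under the
homomorphism to `G_Σ` defined by the tautological lift of `w`, the evaluation for `w` is the image
of `r`, which is central, and the one for `v` is the image of `Θ r` (`ev_hat_eq_hatLift`). It
remains to see that these images agree.

If `d > 0`, then `Θ r` lies in the normal closure of `r`, so its image is the `k`-th power of that
of `r` for some `k`; counting the letters `γᵢ` gives `d = k d`, hence `k = 1`.

If `d = 0`, the count says nothing. Instead `f` is deformed to a map `F` under which the centre `p`
of the polygon is the only preimage of `p`, with positive Jacobian there (`pushesTo`). Then `F` acts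
on `π₁(C ∖ {p})`, which is free on the loops, and `r` or its inverse is a loop around `p`. So `Θ r`
is conjugate to `r`. The change of base points costs an inner automorphism of `G`, which disappears
modulo `Aut(G)`. -/

noncomputable section

namespace Hurwitz

/-! ### Change of base point and free homotopy of loops -/

section FreeHomotopy

open CategoryTheory

variable {X Y Z : Type*} [TopologicalSpace X] [TopologicalSpace Y] [TopologicalSpace Z]

/-- The identification of `π₁(X, y)` with `π₁(X, x)` along a path from `x` to `y`. -/
abbrev alongPath {x y : X} (l : Path x y) : FundamentalGroup X y ≃* FundamentalGroup X x :=
  (FundamentalGroup.fundamentalGroupMulEquivOfPath l).symm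

theorem alongPath_apply {x y : X} (l : Path x y) (z : FundamentalGroup X y) :
    alongPath l z = (FundamentalGroupoid.fromPath (Path.Homotopic.Quotient.mk l)) ≫ z ≫
        Groupoid.inv (FundamentalGroupoid.fromPath (Path.Homotopic.Quotient.mk l)) :=
  rfl

theorem alongPath_trans {x y w : X} (l : Path x y) (m : Path y w) (z : FundamentalGroup X w) :
    alongPath (l.trans m) z = alongPath l (alongPath m z) := by
  have h : FundamentalGroupoid.fromPath (Path.Homotopic.Quotient.mk (l.trans m)) =
      FundamentalGroupoid.fromPath (Path.Homotopic.Quotient.mk l) ≫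
        FundamentalGroupoid.fromPath (Path.Homotopic.Quotient.mk m) := rfl
  simp only [alongPath_apply, h, Groupoid.inv_eq_inv, IsIso.inv_comp, Category.assoc]

/-- Identifications along two paths differ by an inner automorphism. -/
theorem alongPath_conj {x y : X} (l m : Path x y) :
    ∃ δ : FundamentalGroup X x, ∀ z : FundamentalGroup X y,
      alongPath l z = δ * alongPath m z * δ⁻¹ := by
  let p := FundamentalGroupoid.fromPath (Path.Homotopic.Quotient.mk l)
  let q := FundamentalGroupoid.fromPath (Path.Homotopic.Quotient.mk m)
  -- Products in the fundamental group are compositions in the reverse order, so the loop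
  -- conjugating on the left is `q` followed by the inverse of `p`.
  let δ : FundamentalGroup X x := q ≫ Groupoid.inv p
  let δ' : FundamentalGroup X x := p ≫ Groupoid.inv q
  have h : δ⁻¹ = δ' := by
    refine inv_eq_of_mul_eq_one_right ?_
    change (p ≫ Groupoid.inv q) ≫ q ≫ Groupoid.inv p = 𝟙 _
    simp [Groupoid.inv_eq_inv]
  refine ⟨δ, fun z => ?_⟩
  rw [h, alongPath_apply, alongPath_apply]
  change p ≫ z ≫ Groupoid.inv p =
    (p ≫ Groupoid.inv q) ≫ (q ≫ z ≫ Groupoid.inv q) ≫ q ≫ Groupoid.inv p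
  simp [Groupoid.inv_eq_inv]

theorem map_alongPath (F : C(X, Y)) {x y : X} (l : Path x y) (z : FundamentalGroup X y) :
    FundamentalGroup.map F x (alongPath l z) =
      alongPath (l.map F.continuous) (FundamentalGroup.map F y z) := by
  let p := FundamentalGroupoid.fromPath (Path.Homotopic.Quotient.mk l)
  change (FundamentalGroupoid.map F).map (p ≫ z ≫ Groupoid.inv p) =
    (FundamentalGroupoid.map F).map p ≫ (FundamentalGroupoid.map F).map z ≫
      Groupoid.inv ((FundamentalGroupoid.map F).map p)
  simp only [Functor.map_comp, Groupoid.inv_eq_inv, Functor.map_inv]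

theorem fundamentalGroup_map_comp (F : C(Y, Z)) (f : C(X, Y)) (x : X)
    (z : FundamentalGroup X x) :
    FundamentalGroup.map (F.comp f) x z =
      FundamentalGroup.map F (f x) (FundamentalGroup.map f x z) := by
  induction z using Path.Homotopic.Quotient.ind with | mk z => rfl

/-- The path is the track of `x` under the homotopy, and the formula is naturality of the induced
transformation of groupoid functors. -/
theorem exists_map_eq_alongPath {f g : C(X, Y)} (h : f.Homotopic g) (x : X) :
    ∃ n : Path (f x) (g x), ∀ z : FundamentalGroup X x,
      FundamentalGroup.map f x z = alongPath n (FundamentalGroup.map g x z) := by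
  obtain ⟨H⟩ := h
  refine ⟨H.evalAt x, fun z => ?_⟩
  have key := (FundamentalGroupoidFunctor.homotopicMapsNatIso H).naturality (X := ⟨x⟩) (Y := ⟨x⟩) z
  have e : (FundamentalGroupoidFunctor.homotopicMapsNatIso H).app ⟨x⟩ =
    FundamentalGroupoid.fromPath (Path.Homotopic.Quotient.mk (H.evalAt x)) := rfl
  rw [e] at key
  rw [alongPath_apply, Groupoid.inv_eq_inv, ← Category.assoc, IsIso.eq_comp_inv]
  exact key

/-- The free homotopy class of the image of `κ` under `f` is that of `x`. -/
def Represents {o : Z} (κ : FundamentalGroup Z o) (f : C(Z, X)) {y : X}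
    (x : FundamentalGroup X y) : Prop :=
  ∃ l : Path y (f o), x = alongPath l (FundamentalGroup.map f o κ)

namespace Represents

variable {o : Z} {κ : FundamentalGroup Z o} {f g : C(Z, X)} {y y' : X}
  {x : FundamentalGroup X y} {x' : FundamentalGroup X y'}

theorem congr (hx : Represents κ f x) (h : f.Homotopic g) : Represents κ g x := by
  obtain ⟨l, rfl⟩ := hx
  obtain ⟨n, hn⟩ := exists_map_eq_alongPath h o
  exact ⟨l.trans n, by rw [hn, alongPath_trans]⟩

/-- Both connecting paths end at `f o`. This later supplies a path in the complement of a point, so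
that no connectedness of the complement has to be proved. -/
theorem joined (hx : Represents κ f x) (hx' : Represents κ f x') : Joined y y' :=
  ⟨hx.choose.trans hx'.choose.symm⟩

theorem isConj {x' : FundamentalGroup X y} (hx : Represents κ f x) (hx' : Represents κ f x') :
    IsConj x x' := by
  obtain ⟨l, rfl⟩ := hx
  obtain ⟨l', rfl⟩ := hx'
  obtain ⟨δ, hδ⟩ := alongPath_conj l' l
  exact isConj_iff.mpr ⟨δ, (hδ _).symm⟩

theorem map (hx : Represents κ f x) (F : C(X, Y)) :
    Represents κ (F.comp f) (FundamentalGroup.map F y x) := by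
  obtain ⟨l, rfl⟩ := hx
  exact ⟨l.map F.continuous, by rw [map_alongPath, fundamentalGroup_map_comp]⟩

theorem alongPath (hx : Represents κ f x) (m : Path y' y) :
    Represents κ f (alongPath m x) := by
  obtain ⟨l, rfl⟩ := hx
  exact ⟨m.trans l, by rw [alongPath_trans]⟩

end Represents

end FreeHomotopy

/-! ### Loops in a punctured disc -/

section PuncturedDisc

/-- A generator of `π₁(S¹, 1)`, the loop which runs once counterclockwise around the circle. -/
def circlePath : Path (1 : Circle) 1 where
  toFun t := Circle.exp (2 * Real.pi * (t : ℝ))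
  continuous_toFun := by fun_prop
  source' := by simp
  target' := by simp

/-- The class of `circlePath`. -/
def circleLoop : FundamentalGroup Circle 1 :=
  FundamentalGroup.fromPath (Path.Homotopic.Quotient.mk circlePath)

/-- The punctured closed disc of radius `r` around `0`. -/
abbrev PuncturedDisc (r : ℝ) : Type := {z : ℂ // z ≠ 0 ∧ ‖z‖ ≤ r}

/-- The circle `u ↦ a u` in a punctured disc. -/
def scaledCircle {r : ℝ} (a : PuncturedDisc r) : C(Circle, PuncturedDisc r) where
  toFun u := ⟨a * u, by simpa using a.2.1, by simpa [Circle.norm_coe] using a.2.2⟩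
  continuous_toFun := by fun_prop

/-- The straight-line homotopy misses `0` by the hypothesis on norms and stays in the disc by
convexity. -/
theorem homotopic_scaledCircle {r : ℝ} (f : C(Circle, PuncturedDisc r)) (a : PuncturedDisc r)
    (h : ∀ u : Circle, ‖(f u : ℂ) - a * u‖ < ‖(a : ℂ)‖) : f.Homotopic (scaledCircle a) := by
  refine ⟨⟨⟨fun p => ⟨a * p.2 + (1 - (p.1 : ℝ) : ℝ) • ((f p.2 : ℂ) - a * p.2), ?_, ?_⟩, ?_⟩, ?_, ?_⟩⟩
  · intro h0
    have h1 := h p.2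
    have h2 : ‖(a : ℂ) * p.2‖ = ‖(1 - (p.1 : ℝ) : ℝ) • ((f p.2 : ℂ) - a * p.2)‖ := by
      rw [← norm_neg, ← eq_neg_of_add_eq_zero_right h0]
    rw [norm_mul, Circle.norm_coe, mul_one, norm_smul, Real.norm_of_nonneg (by linarith [p.1.2.2])] at h2
    nlinarith [p.1.2.1, norm_nonneg ((f p.2 : ℂ) - a * p.2)]
  · have h3 := (convex_closedBall (0 : ℂ) r).add_smul_sub_mem (x := (a : ℂ) * p.2) (y := f p.2)
      (by simpa [Circle.norm_coe] using a.2.2) (by simpa using (f p.2).2.2) (t := 1 - (p.1 : ℝ))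
      ⟨by linarith [p.1.2.2], by linarith [p.1.2.1]⟩
    simpa using h3
  · fun_prop
  · intro u
    simp
  · intro u
    simp [scaledCircle]

/-- Rotate `a` and `b` to the positive real axis, then interpolate the radii linearly. -/
theorem scaledCircle_homotopic {r : ℝ} (a b : PuncturedDisc r) :
    (scaledCircle a).Homotopic (scaledCircle b) := by
  have h : ∀ a : PuncturedDisc r, (scaledCircle a).Homotopic (scaledCircle
      (⟨‖(a : ℂ)‖, by simpa using a.2.1, by simpa using a.2.2⟩ : PuncturedDisc r)) := by
    intro a
    refine ⟨⟨⟨fun p => ⟨‖(a : ℂ)‖ * Complex.exp (((1 - (p.1 : ℝ)) * (a : ℂ).arg : ℝ) * Complex.I) * p.2,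
      ?_, ?_⟩, ?_⟩, ?_, ?_⟩⟩
    · simpa using a.2.1
    · rw [norm_mul, norm_mul, Complex.norm_exp_ofReal_mul_I, Circle.norm_coe]
      simpa using a.2.2
    · fun_prop
    · intro u
      simp [scaledCircle, Complex.norm_mul_exp_arg_mul_I]
    · intro u
      simp [scaledCircle]
  refine (h a).trans (ContinuousMap.Homotopic.trans ?_ (h b).symm)
  have pa : 0 < ‖(a : ℂ)‖ := norm_pos_iff.mpr a.2.1
  have pb : 0 < ‖(b : ℂ)‖ := norm_pos_iff.mpr b.2.1
  have key : ∀ t : unitInterval, 0 < (1 - (t : ℝ)) * ‖(a : ℂ)‖ + t * ‖(b : ℂ)‖ ∧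
      (1 - (t : ℝ)) * ‖(a : ℂ)‖ + t * ‖(b : ℂ)‖ ≤ r := by
    intro t
    have h0 := t.2.1
    have h1 := t.2.2
    constructor
    · rcases h0.eq_or_lt with h | h
      · simp [← h, pa]
      · have := mul_pos h pb
        have := mul_nonneg (sub_nonneg.mpr h1) pa.le
        linarith
    · nlinarith [a.2.2, b.2.2]
  refine ⟨⟨⟨fun p => ⟨((((1 - (p.1 : ℝ)) * ‖(a : ℂ)‖ + p.1 * ‖(b : ℂ)‖ : ℝ) : ℂ) * p.2),
      ?_, ?_⟩, ?_⟩, ?_, ?_⟩⟩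
  · have := (key p.1).1.ne'
    exact mul_ne_zero (by exact_mod_cast this) (by simp)
  · rw [norm_mul, Circle.norm_coe, mul_one, Complex.norm_real, Real.norm_of_nonneg (key p.1).1.le]
    exact (key p.1).2
  · fun_prop
  · intro u
    simp [scaledCircle]
  · intro u
    simp [scaledCircle]

/-- An orientation preserving real linear map `z ↦ α z + β z̄` has `‖β‖ < ‖α‖`. -/
theorem exists_conj_decomposition (A : ℂ →L[ℝ] ℂ) (hA : 0 < LinearMap.det (A : ℂ →ₗ[ℝ] ℂ)) :
    ∃ α β : ℂ, (∀ z, A z = α * z + β * (starRingEnd ℂ) z) ∧ ‖β‖ < ‖α‖ := by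
  have hz : ∀ z : ℂ, A z = z.re • A 1 + z.im • A Complex.I := by
    intro z
    rw [← map_smul, ← map_smul, ← map_add]
    congr 1
    apply Complex.ext <;> simp
  have hdet : LinearMap.det (A : ℂ →ₗ[ℝ] ℂ) =
      (A 1).re * (A Complex.I).im - (A Complex.I).re * (A 1).im := by
    rw [← LinearMap.det_toMatrix Complex.basisOneI, Matrix.det_fin_two]
    simp [LinearMap.toMatrix_apply]
  -- These are the Wirtinger derivatives of `A`, and `‖α‖² - ‖β‖²` is its determinant.
  refine ⟨(A 1 - Complex.I * A Complex.I) / 2, (A 1 + Complex.I * A Complex.I) / 2, ?_, ?_⟩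
  · intro z
    rw [hz]
    apply Complex.ext <;> simp <;> ring
  · rw [← sq_lt_sq₀ (norm_nonneg _) (norm_nonneg _), ← Complex.normSq_eq_norm_sq,
      ← Complex.normSq_eq_norm_sq, Complex.normSq_apply, Complex.normSq_apply]
    rw [hdet] at hA
    simp
    nlinarith

end PuncturedDisc

/-! ### Loops around a point and maps of positive Jacobian -/

section LoopsAround

variable {C : Type*} [TopologicalSpace C] [ChartedSpace ℂ C]

/-- A closed disc around `p`, in the chart chosen at `p`, whose only point in `B` is `p`. -/
structure IsDiscAround (B : Set C) (p : C) (r : ℝ) : Prop where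
  mem : p ∈ B
  pos : 0 < r
  subset : Metric.closedBall (chartAt ℂ p p) r ⊆ (chartAt ℂ p).target
  eq_centre : ∀ z ∈ Metric.closedBall (chartAt ℂ p p) r,
    (chartAt ℂ p).symm z ∈ B → z = chartAt ℂ p p

namespace IsDiscAround

variable {B : Set C} {p : C} {r : ℝ}

theorem add_mem (_ : IsDiscAround B p r) {z : ℂ} (hz : ‖z‖ ≤ r) :
    chartAt ℂ p p + z ∈ Metric.closedBall (chartAt ℂ p p) r := by
  simpa using hz

/-- The inclusion of the punctured disc around `p`. -/
def incl (h : IsDiscAround B p r) : C(PuncturedDisc r, Punctured B) where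
  toFun z := ⟨(chartAt ℂ p).symm (chartAt ℂ p p + z), fun hz =>
    z.2.1 (by simpa using h.eq_centre _ (h.add_mem z.2.2) hz)⟩
  continuous_toFun := by
    refine Continuous.subtype_mk ?_ _
    exact (chartAt ℂ p).continuousOn_symm.comp_continuous (by fun_prop)
      fun z => h.subset (h.add_mem z.2.2)

/-- The radius of the disc as a point of the punctured disc. -/
def radius (h : IsDiscAround B p r) : PuncturedDisc r :=
  ⟨r, by exact_mod_cast h.pos.ne', by simp [abs_of_pos h.pos]⟩

end IsDiscAround

/-- All circles in the punctured disc are freely homotopic, so the one in the definition can be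
replaced by one as small, and with as suitable a phase, as a comparison requires. -/
theorem IsLoopAround.exists_represents {B : Set C} {y₀ : Punctured B} {p : C}
    {x : FundamentalGroup (Punctured B) y₀} (hx : IsLoopAround p x) :
    ∃ (r : ℝ) (h : IsDiscAround B p r), ∀ a : PuncturedDisc r,
      Represents circleLoop (h.incl.comp (scaledCircle a)) x := by
  obtain ⟨hp, r, hr, hsub, hB, s, circle, l, hc, rfl⟩ := hx
  let h : IsDiscAround B p r := ⟨hp, hr, hsub, hB⟩
  refine ⟨r, h, fun a => Represents.congr (f := h.incl.comp (scaledCircle h.radius)) ?_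
    ((ContinuousMap.Homotopic.refl h.incl).comp (scaledCircle_homotopic _ a))⟩
  have hs : s = h.incl.comp (scaledCircle h.radius) 1 := by
    apply Subtype.ext
    rw [← circle.source, hc]
    simp [IsDiscAround.incl, scaledCircle, IsDiscAround.radius]
  subst hs
  refine ⟨l, ?_⟩
  have e : circle = circlePath.map (h.incl.comp (scaledCircle h.radius)).continuous := by
    ext t
    rw [hc]
    change _ = (chartAt ℂ p).symm (chartAt ℂ p p + r * (Circle.exp (2 * Real.pi * (t : ℝ)) : ℂ))
    rw [Circle.coe_exp]
    push_cast
    congr 4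
    ring
  subst e
  rw [alongPath_apply, ← CategoryTheory.Category.assoc]
  rfl

/-- The germ of `f` at `p` is differentiable with positive Jacobian. -/
def PosJacobianAt (f : C → C) (p : C) : Prop :=
  MDifferentiableAt 𝓘(ℝ, ℂ) 𝓘(ℝ, ℂ) f p ∧ 0 < jacobian f p

theorem PosJacobianAt.comp {f h : C → C} {p : C} (hh : PosJacobianAt h (f p))
    (hf : PosJacobianAt f p) : PosJacobianAt (h ∘ f) p :=
  ⟨hh.1.comp p hf.1, by rw [jacobian_comp p hh.1 hf.1]; exact mul_pos hh.2 hf.2⟩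

theorem posJacobianAt_of_hasFDerivAt {f : C → C} {p : C} {A : ℂ →L[ℝ] ℂ} (hc : ContinuousAt f p)
    (hf : HasFDerivAt (fun z => chartAt ℂ (f p) (f ((chartAt ℂ p).symm z))) A (chartAt ℂ p p))
    (hA : 0 < LinearMap.det (A : ℂ →ₗ[ℝ] ℂ)) : PosJacobianAt f p := by
  have h : HasMFDerivAt 𝓘(ℝ, ℂ) 𝓘(ℝ, ℂ) f p A := ⟨hc, hf.hasFDerivWithinAt⟩
  refine ⟨h.mdifferentiableAt, ?_⟩
  unfold jacobian
  rw [h.mfderiv]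
  exact hA

theorem PosJacobianAt.hasFDerivAt {f : C → C} {p : C} (hf : PosJacobianAt f p) :
    ∃ A : ℂ →L[ℝ] ℂ, 0 < LinearMap.det (A : ℂ →ₗ[ℝ] ℂ) ∧
      HasFDerivAt (fun z => chartAt ℂ (f p) (f ((chartAt ℂ p).symm z))) A (chartAt ℂ p p) := by
  refine ⟨mfderiv 𝓘(ℝ, ℂ) 𝓘(ℝ, ℂ) f p, hf.2, ?_⟩
  have h := hf.1.hasMFDerivAt.2
  rw [ModelWithCorners.range_eq_univ] at h
  exact h.hasFDerivAt Filter.univ_mem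

/-- A map with positive Jacobian at `p` takes loops around `p` to loops around the image of `p`, up
to free homotopy. -/
theorem exists_represents_map {B B' : Set C} {p : C} {f : C → C} (hf : PosJacobianAt f p)
    (F : C(Punctured B, Punctured B')) (hF : ∀ x, (F x : C) = f x)
    {y : Punctured B} {x : FundamentalGroup (Punctured B) y} (hx : IsLoopAround p x)
    {y' : Punctured B'} {x' : FundamentalGroup (Punctured B') y'} (hx' : IsLoopAround (f p) x') :
    ∃ g : C(Circle, Punctured B'),
      Represents circleLoop g (FundamentalGroup.map F y x) ∧ Represents circleLoop g x' := by
  obtain ⟨r, h, hr⟩ := hx.exists_represents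
  obtain ⟨r', h', hr'⟩ := hx'.exists_represents
  obtain ⟨A, hA, hd⟩ := hf.hasFDerivAt
  obtain ⟨α, β, hαβ, hlt⟩ := exists_conj_decomposition A hA
  have hα : 0 < ‖α‖ := (norm_nonneg β).trans_lt hlt
  set c := chartAt ℂ p p
  set c' := chartAt ℂ (f p) (f p)
  set G : ℂ → ℂ := fun z => chartAt ℂ (f p) (f ((chartAt ℂ p).symm z)) with hG
  have hsymm : (chartAt ℂ p).symm c = p := (chartAt ℂ p).left_inv (mem_chart_source ℂ p)
  have hGc : G c = c' := by simp only [hG, hsymm]; rfl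
  have hct : c ∈ (chartAt ℂ p).target := (chartAt ℂ p).map_source (mem_chart_source ℂ p)
  have hcs : ContinuousAt (fun z => f ((chartAt ℂ p).symm z)) c := by
    refine ContinuousAt.comp (g := f) ?_ ((chartAt ℂ p).continuousAt_symm hct)
    rw [hsymm]
    exact hf.1.continuousAt
  have e1 : ∀ᶠ z in nhds c, f ((chartAt ℂ p).symm z) ∈ (chartAt ℂ (f p)).source := by
    refine hcs ((chartAt ℂ (f p)).open_source.mem_nhds ?_)
    simp only [hsymm]
    exact mem_chart_source ℂ (f p)
  have e2 : ∀ᶠ z in nhds c, ‖G z - c'‖ ≤ r' := by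
    have := hd.continuousAt (Metric.closedBall_mem_nhds (G c) h'.pos)
    filter_upwards [this] with z hz
    simpa [hGc, dist_eq_norm] using hz
  -- Half of the gap between `‖α‖` and `‖β‖` is spent on the error of the linear approximation, so
  -- that error and antiholomorphic part together stay below `‖α‖ ‖z - c‖`.
  have e3 : ∀ᶠ z in nhds c, ‖G z - G c - A (z - c)‖ ≤ ((‖α‖ - ‖β‖) / 2) * ‖z - c‖ :=
    hd.isLittleO.def (by linarith)
  obtain ⟨ε, hε, hball⟩ := Metric.eventually_nhds_iff.mp (e1.and (e2.and e3))
  -- The circle of radius `ρ` must fit in the disc at `p`, the estimates must hold on it, and the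
  -- comparison circle `u ↦ α ρ u` must fit in the disc at `f p`.
  obtain ⟨ρ, hρ, hρr, hρε, hρα⟩ : ∃ ρ : ℝ, 0 < ρ ∧ ρ ≤ r ∧ ρ < ε ∧ ‖α‖ * ρ ≤ r' := by
    refine ⟨min r (min (ε / 2) (r' / ‖α‖)), ?_, min_le_left _ _, ?_, ?_⟩
    · exact lt_min h.pos (lt_min (half_pos hε) (div_pos h'.pos hα))
    · exact ((min_le_right _ _).trans (min_le_left _ _)).trans_lt (half_lt_self hε)
    · rw [mul_comm, ← le_div_iff₀ hα]
      exact (min_le_right _ _).trans (min_le_right _ _)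
  have hu : ∀ u : Circle, ‖(ρ : ℂ) * u‖ = ρ := fun u => by
    rw [norm_mul, Circle.norm_coe, mul_one, Complex.norm_real, Real.norm_of_nonneg hρ.le]
  have hb : ∀ u : Circle, f ((chartAt ℂ p).symm (c + ρ * u)) ∈ (chartAt ℂ (f p)).source ∧
      ‖G (c + ρ * u) - c'‖ ≤ r' ∧ ‖G (c + ρ * u) - c' - A (ρ * u)‖ ≤ ((‖α‖ - ‖β‖) / 2) * ρ := by
    intro u
    have := hball (y := c + ρ * u) (by simpa [abs_of_pos hρ, Circle.norm_coe] using hρε)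
    rw [add_sub_cancel_left, hu, hGc] at this
    exact this
  have hclose : ∀ u : Circle, ‖G (c + ρ * u) - c' - (α * ρ) * u‖ < ‖α * ρ‖ := by
    intro u
    have e : G (c + ρ * u) - c' - (α * ρ) * u =
        (G (c + ρ * u) - c' - A (ρ * u)) + β * (starRingEnd ℂ) (ρ * u) := by
      rw [hαβ]; ring
    have n1 : ‖α * ρ‖ = ‖α‖ * ρ := by
      rw [norm_mul, Complex.norm_real, Real.norm_of_nonneg hρ.le]
    rw [e, n1]
    refine (norm_add_le _ _).trans_lt ?_
    rw [norm_mul, RCLike.norm_conj, hu]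
    have := (hb u).2.2
    nlinarith
  let a : PuncturedDisc r := ⟨ρ, by exact_mod_cast hρ.ne', by simpa [abs_of_pos hρ] using hρr⟩
  let a' : PuncturedDisc r' := ⟨α * ρ, mul_ne_zero (norm_pos_iff.mp hα) (by exact_mod_cast hρ.ne'),
    by rw [norm_mul, Complex.norm_real, Real.norm_of_nonneg hρ.le]; exact hρα⟩
  have hmem : ∀ u : Circle, c + ρ * u ∈ Metric.closedBall c r := fun u => by
    simpa [abs_of_pos hρ, Circle.norm_coe] using hρr
  let g : C(Circle, PuncturedDisc r') :=
    { toFun := fun u => ⟨G (c + ρ * u) - c', by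
        intro h0
        have := hclose u
        rw [h0, zero_sub, norm_neg, norm_mul _ (u : ℂ), Circle.norm_coe, mul_one] at this
        exact lt_irrefl _ this, (hb u).2.1⟩
      continuous_toFun := by
        refine Continuous.subtype_mk (Continuous.sub ?_ continuous_const) _
        have k1 : Continuous fun u : Circle => F (h.incl.comp (scaledCircle a) u) := by fun_prop
        have k2 : Continuous fun u : Circle => f ((chartAt ℂ p).symm (c + ρ * u)) := by
          refine (continuous_subtype_val.comp k1).congr fun u => ?_
          simp [hF]
          rfl
        exact (chartAt ℂ (f p)).continuousOn.comp_continuous k2 fun u => (hb u).1 }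
  have hg : g.Homotopic (scaledCircle a') := homotopic_scaledCircle g a' hclose
  refine ⟨h'.incl.comp g, ?_, (hr' a').congr
    ((ContinuousMap.Homotopic.refl h'.incl).comp hg.symm)⟩
  -- `g` is the image of the small circle under `F`, read in the chart at `f p`.
  have e : h'.incl.comp g = F.comp (h.incl.comp (scaledCircle a)) := by
    ext u
    rw [ContinuousMap.comp_apply, ContinuousMap.comp_apply, hF]
    change (chartAt ℂ (f p)).symm (c' + (G (c + ρ * u) - c')) = f ((chartAt ℂ p).symm (c + ρ * u))
    rw [add_sub_cancel]
    exact (chartAt ℂ (f p)).left_inv (hb u).1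
  rw [e]
  exact (hr a).map F

end LoopsAround

/-! ### Moving a point by a map homotopic to the identity -/

section Pushing

variable {C : Type*} [TopologicalSpace C] [ChartedSpace ℂ C]

/-- Chart changes are holomorphic in both directions, so by the chain rule a zero derivative would
make the identity have derivative zero. -/
theorem hasDerivAt_coordChange [IsManifold 𝓘(ℂ) ω C] (x x' : C) {z : ℂ}
    (hz : z ∈ (chartAt ℂ x').target) (hz' : (chartAt ℂ x').symm z ∈ (chartAt ℂ x).source) :
    ∃ w : ℂ, w ≠ 0 ∧ HasDerivAt (fun y => chartAt ℂ x ((chartAt ℂ x').symm y)) w z := by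
  have hdiff : ∀ (x x' : C) {z : ℂ}, z ∈ (chartAt ℂ x').target →
      (chartAt ℂ x').symm z ∈ (chartAt ℂ x).source →
      DifferentiableAt ℂ (fun y => chartAt ℂ x ((chartAt ℂ x').symm y)) z := by
    intro x x' z hz hz'
    have h := contDiffWithinAt_ext_coord_change (I := 𝓘(ℂ)) (n := ω) x x' (y := z)
      (by simpa using ⟨hz, hz'⟩)
    rw [ModelWithCorners.range_eq_univ] at h
    exact (h.contDiffAt Filter.univ_mem).differentiableAt (by simp)
  set z' := chartAt ℂ x ((chartAt ℂ x').symm z) with hzz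
  have hback : (chartAt ℂ x).symm z' = (chartAt ℂ x').symm z := (chartAt ℂ x).left_inv hz'
  have h1 := (hdiff x x' hz hz').hasDerivAt
  have h2 := (hdiff x' x (z := z') ((chartAt ℂ x).map_source hz')
    (by rw [hback]; exact (chartAt ℂ x').map_target hz)).hasDerivAt
  refine ⟨_, fun h0 => ?_, h1⟩
  have h3 := HasDerivAt.comp z h2 h1
  rw [h0, mul_zero] at h3
  have hid : HasDerivAt (id : ℂ → ℂ) 0 z := by
    refine h3.congr_of_eventuallyEq ?_
    have e1 : ∀ᶠ y in nhds z, y ∈ (chartAt ℂ x').target :=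
      (chartAt ℂ x').open_target.mem_nhds hz
    have e2 : ∀ᶠ y in nhds z, (chartAt ℂ x').symm y ∈ (chartAt ℂ x).source :=
      ((chartAt ℂ x').continuousAt_symm hz) ((chartAt ℂ x).open_source.mem_nhds hz')
    filter_upwards [e1, e2] with y hy hy'
    simp only [id, Function.comp_apply]
    rw [(chartAt ℂ x).left_inv hy', (chartAt ℂ x').right_inv hy]
  exact zero_ne_one (hid.unique (hasDerivAt_id z))

/-- The determinant is `|w|²`. Hence holomorphic chart changes do not affect the sign of a Jacobian.
-/
theorem det_smul_one_pos {w : ℂ} (hw : w ≠ 0) :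
    0 < LinearMap.det ((w • (1 : ℂ →L[ℝ] ℂ) : ℂ →L[ℝ] ℂ) : ℂ →ₗ[ℝ] ℂ) := by
  rw [← LinearMap.det_toMatrix Complex.basisOneI, Matrix.det_fin_two]
  simp only [LinearMap.toMatrix_apply]
  simp
  have := Complex.normSq_pos.mpr hw
  rwa [Complex.normSq_apply] at this

/-- A bump function supported in the ball of radius `R` around `c`. -/
def bump (c : ℂ) (R : ℝ) (z : ℂ) : ℝ := max 0 (1 - ‖z - c‖ ^ 2 / R ^ 2)

theorem continuous_bump (c : ℂ) (R : ℝ) : Continuous (bump c R) := by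
  unfold bump; fun_prop

theorem bump_eq_zero {c : ℂ} {R : ℝ} (hR : 0 < R) {z : ℂ} (hz : R ≤ ‖z - c‖) :
    bump c R z = 0 := by
  refine max_eq_left ?_
  rw [sub_nonpos, one_le_div (by positivity)]
  gcongr

theorem bump_of_le {c : ℂ} {R : ℝ} (hR : 0 < R) {z : ℂ} (hz : ‖z - c‖ ≤ R) :
    bump c R z = 1 - ‖z - c‖ ^ 2 / R ^ 2 := by
  refine max_eq_right ?_
  rw [sub_nonneg, div_le_one (by positivity)]
  gcongr

/-- At distance `s ≤ R` from `c` the displacement is at most `(1 - s²/R²) R/2 = (R - s)(R + s)/(2R)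
≤ R - s`, so the ball is mapped to itself; nothing moves outside it. -/
theorem add_bump_mem {c a : ℂ} {R : ℝ} (hR : 0 < R) (ha : ‖a‖ ≤ R / 2) {s : Set ℂ}
    (hs : Metric.closedBall c R ⊆ s) {t : ℝ} (h0 : 0 ≤ t) (h1 : t ≤ 1) {z : ℂ} (hz : z ∈ s) :
    z + (t * bump c R z) • a ∈ s := by
  rcases le_total R ‖z - c‖ with h | h
  · simpa [bump_eq_zero hR h] using hz
  · refine hs ?_
    rw [mem_closedBall_iff_norm, add_sub_right_comm]
    refine (norm_add_le _ _).trans ?_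
    have hb : 0 ≤ bump c R z := le_max_left _ _
    rw [norm_smul, Real.norm_of_nonneg (mul_nonneg h0 hb)]
    have h2 : t * bump c R z * ‖a‖ ≤ bump c R z * (R / 2) := by
      calc t * bump c R z * ‖a‖ ≤ 1 * bump c R z * (R / 2) := by gcongr
        _ = _ := by ring
    have h3 : bump c R z * (R / 2) ≤ R - ‖z - c‖ := by
      rw [bump_of_le hR h]
      have : (1 - ‖z - c‖ ^ 2 / R ^ 2) * (R / 2) = (R - ‖z - c‖) * ((R + ‖z - c‖) / (2 * R)) := by
        field_simp
        ring
      rw [this]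
      refine mul_le_of_le_one_right (by linarith) ?_
      rw [div_le_one (by positivity)]
      linarith
    linarith

/-- Inside the ball the equation reads `z - c = (s²/R²) a` with `s = ‖z - c‖`, whence `s ≤ s/2`.
Outside it, `z` would equal `c + a`, which is at distance at most `R/2` from `c`. -/
theorem eq_of_add_bump_eq {c a : ℂ} {R : ℝ} (hR : 0 < R) (ha : ‖a‖ ≤ R / 2) {z : ℂ}
    (h : z + bump c R z • a = c + a) : z = c := by
  rcases le_total R ‖z - c‖ with h1 | h1
  · rw [bump_eq_zero hR h1, zero_smul, add_zero] at h
    rw [h, add_sub_cancel_left] at h1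
    linarith
  · rw [bump_of_le hR h1] at h
    have e : z - c = (‖z - c‖ ^ 2 / R ^ 2) • a := by
      rw [sub_smul, one_smul] at h
      linear_combination h
    have n := congrArg norm e
    rw [norm_smul, Real.norm_of_nonneg (by positivity)] at n
    have hn := norm_nonneg (z - c)
    by_contra hne
    have hpos : 0 < ‖z - c‖ := norm_pos_iff.mpr (sub_ne_zero.mpr hne)
    have : ‖z - c‖ ^ 2 / R ^ 2 * ‖a‖ ≤ ‖z - c‖ / 2 := by
      calc ‖z - c‖ ^ 2 / R ^ 2 * ‖a‖ ≤ (‖z - c‖ * R) / R ^ 2 * (R / 2) := by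
            rw [pow_two ‖z - c‖]; gcongr
        _ = ‖z - c‖ / 2 := by field_simp
    linarith

/-- Near `c` the bump is `1` minus a multiple of the squared distance, so its derivative at `c`
vanishes. -/
theorem hasFDerivAt_add_bump (c a : ℂ) {R : ℝ} (hR : 0 < R) :
    HasFDerivAt (fun z => z + bump c R z • a) (ContinuousLinearMap.id ℝ ℂ) c := by
  have h1 : HasFDerivAt (fun z : ℂ => z + (1 - ‖z - c‖ ^ 2 / R ^ 2) • a)
      (ContinuousLinearMap.id ℝ ℂ) c := by
    have h2 : HasFDerivAt (fun z : ℂ => ‖z - c‖ ^ 2) (0 : ℂ →L[ℝ] ℝ) c := by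
      have := ((hasFDerivAt_id (𝕜 := ℝ) c).sub_const c).norm_sq
      simpa using this
    have h3 := (hasFDerivAt_id (𝕜 := ℝ) c).add
      ((((h2.mul_const (R ^ 2)⁻¹).const_sub 1)).smul_const a)
    have e : ContinuousLinearMap.id ℝ ℂ + (-((R ^ 2)⁻¹ • (0 : ℂ →L[ℝ] ℝ))).smulRight a =
        ContinuousLinearMap.id ℝ ℂ := by
      ext
      simp
    rw [e] at h3
    exact h3
  refine h1.congr_of_eventuallyEq ?_
  filter_upwards [Metric.closedBall_mem_nhds c hR] with z hz
  rw [bump_of_le hR (by simpa [dist_eq_norm] using hz)]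

/-- There is a continuous map, homotopic to the identity, which takes only `p` to `q` and preserves
the orientation at `p`. -/
def PushesTo (p q : C) : Prop :=
  ∃ h : C(C, C), h.Homotopic (ContinuousMap.id C) ∧ h p = q ∧ (∀ x, h x = q → x = p) ∧
    PosJacobianAt h p

theorem PushesTo.trans {p q r : C} (h : PushesTo p q) (h' : PushesTo q r) : PushesTo p r := by
  obtain ⟨f, f1, rfl, f3, f4⟩ := h
  obtain ⟨g, g1, rfl, g3, g4⟩ := h'
  exact ⟨g.comp f, by simpa using g1.comp f1, rfl, fun x hx => f3 x (g3 _ hx), g4.comp f4⟩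

open Classical in
/-- The displacement `bump`, in the chart chosen at `x₀`. -/
def chartPush (x₀ : C) (c a : ℂ) (R : ℝ) (t : ℝ) (x : C) : C :=
  if x ∈ (chartAt ℂ x₀).source then
    (chartAt ℂ x₀).symm (chartAt ℂ x₀ x + (t * bump c R (chartAt ℂ x₀ x)) • a) else x

/-- On the chart domain the formula is continuous; off the image of the closed ball nothing moves.
These two open sets cover the surface. -/
theorem continuous_chartPush [T2Space C] {x₀ : C} {c a : ℂ} {R : ℝ} (hR : 0 < R)
    (ha : ‖a‖ ≤ R / 2) (hs : Metric.closedBall c R ⊆ (chartAt ℂ x₀).target) :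
    Continuous fun p : unitInterval × C => chartPush x₀ c a R p.1 p.2 := by
  set φ := chartAt ℂ x₀ with hφ
  -- A compact set, hence closed as the surface is Hausdorff.
  let K : Set C := φ.symm '' Metric.closedBall c R
  have hK : IsClosed K :=
    ((isCompact_closedBall c R).image_of_continuousOn (φ.continuousOn_symm.mono hs)).isClosed
  rw [continuous_iff_continuousAt]
  rintro ⟨t, x⟩
  by_cases hx : x ∈ φ.source
  · have h1 : ContinuousOn (fun p : unitInterval × C =>
        φ.symm (φ p.2 + ((p.1 : ℝ) * bump c R (φ p.2)) • a)) (Set.univ ×ˢ φ.source) := by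
      have k1 : ContinuousOn (fun p : unitInterval × C => φ p.2) (Set.univ ×ˢ φ.source) :=
        φ.continuousOn.comp continuousOn_snd fun p hp => hp.2
      refine φ.continuousOn_symm.comp (k1.add (ContinuousOn.smul (ContinuousOn.mul
        (by fun_prop) ((continuous_bump c R).comp_continuousOn k1)) continuousOn_const)) ?_
      rintro p hp
      exact add_bump_mem hR ha hs p.1.2.1 p.1.2.2 (φ.map_source hp.2)
    have hn : Set.univ ×ˢ φ.source ∈ nhds (t, x) :=
      (isOpen_univ.prod φ.open_source).mem_nhds ⟨trivial, hx⟩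
    refine (h1.continuousAt hn).congr ?_
    filter_upwards [hn] with p hp
    rw [chartPush, if_pos hp.2]
  · have hxK : x ∉ K := by
      rintro ⟨z, hz, rfl⟩
      exact hx (φ.map_target (hs hz))
    have hn : Set.univ ×ˢ Kᶜ ∈ nhds (t, x) :=
      (isOpen_univ.prod hK.isOpen_compl).mem_nhds ⟨trivial, hxK⟩
    refine continuousAt_snd.congr ?_
    filter_upwards [hn] with p hp
    by_cases hp' : p.2 ∈ φ.source
    · rw [chartPush, if_pos hp', bump_eq_zero hR, mul_zero, zero_smul, add_zero, φ.left_inv hp']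
      by_contra hlt
      exact hp.2 ⟨φ p.2, by simpa [dist_eq_norm] using (not_le.mp hlt).le, φ.left_inv hp'⟩
    · rw [chartPush, if_neg hp']

theorem pushesTo_of_closedBall [T2Space C] [IsManifold 𝓘(ℂ) ω C] {x₀ : C} {c a : ℂ} {R : ℝ}
    (hR : 0 < R) (ha : ‖a‖ ≤ R / 2) (hs : Metric.closedBall c R ⊆ (chartAt ℂ x₀).target) :
    PushesTo ((chartAt ℂ x₀).symm c) ((chartAt ℂ x₀).symm (c + a)) := by
  set φ := chartAt ℂ x₀ with hφ
  have hct : c ∈ φ.target := hs (Metric.mem_closedBall_self hR.le)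
  have hat : c + a ∈ φ.target := hs (by simpa using ha.trans (by linarith))
  have hcont := continuous_chartPush hR ha hs
  let h : C(C, C) := ⟨chartPush x₀ c a R 1, by
    have := hcont.comp (Continuous.prodMk_right (1 : unitInterval))
    simpa [Function.comp_def] using this⟩
  have hh : ∀ x ∈ φ.source, h x = φ.symm (φ x + bump c R (φ x) • a) := by
    intro x hx
    change chartPush x₀ c a R 1 x = _
    rw [chartPush, if_pos hx, one_mul]
  have hbc : bump c R c = 1 := by simp [bump]
  have hhp : h (φ.symm c) = φ.symm (c + a) := by
    rw [hh _ (φ.map_target hct), φ.right_inv hct, hbc, one_smul]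
  refine ⟨h, ContinuousMap.Homotopic.symm
    ⟨⟨⟨fun p => chartPush x₀ c a R p.1 p.2, hcont⟩, fun x => ?_, fun x => ?_⟩⟩, hhp, ?_, ?_⟩
  · by_cases hx : x ∈ φ.source
    · simp only [chartPush]
      rw [if_pos hx]
      simp [← hφ, φ.left_inv hx]
    · simp only [chartPush]
      rw [if_neg hx]
      rfl
  · rfl
  · intro x hx
    by_cases hxs : x ∈ φ.source
    · rw [hh x hxs] at hx
      have hmem := add_bump_mem hR ha hs zero_le_one le_rfl (φ.map_source hxs)
      rw [one_mul] at hmem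
      have := eq_of_add_bump_eq hR ha (φ.symm.injOn hmem hat hx)
      rw [← this, φ.left_inv hxs]
    -- A point outside the chart domain is fixed, while the target of the push lies in the domain.
    · have e : h x = x := by
        change chartPush x₀ c a R 1 x = _
        rw [chartPush, if_neg hxs]
      rw [e] at hx
      exact absurd (hx ▸ φ.map_target hat) hxs
  · set p := φ.symm c with hp
    have hps : p ∈ φ.source := φ.map_target hct
    have hφp : φ p = c := φ.right_inv hct
    have hcp : chartAt ℂ p p ∈ (chartAt ℂ p).target := mem_chart_target ℂ p
    have hpp : (chartAt ℂ p).symm (chartAt ℂ p p) = p :=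
      (chartAt ℂ p).left_inv (mem_chart_source ℂ p)
    -- The Jacobian is measured in the charts at `p` and `h p`, the push is written in the chart at
    -- `x₀`. Each change of chart contributes a nonzero complex factor, the push itself the
    -- identity.
    obtain ⟨w, hw, hwd⟩ := hasDerivAt_coordChange x₀ p hcp (by rw [hpp]; exact hps)
    obtain ⟨w', hw', hwd'⟩ := hasDerivAt_coordChange (h p) x₀ hat
      (by rw [← hφ, ← hhp]; exact mem_chart_source ℂ (h p))
    have d1 : HasFDerivAt (fun y => φ ((chartAt ℂ p).symm y)) (w • (1 : ℂ →L[ℝ] ℂ))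
      (chartAt ℂ p p) := hwd.complexToReal_fderiv
    have d2 := hasFDerivAt_add_bump c a hR
    have d3 : HasFDerivAt (fun y => chartAt ℂ (h p) (φ.symm y)) (w' • (1 : ℂ →L[ℝ] ℂ))
      (c + a) := hwd'.complexToReal_fderiv
    have e1 : c + bump c R c • a = c + a := by rw [hbc, one_smul]
    have e2 : φ ((chartAt ℂ p).symm (chartAt ℂ p p)) = c := by rw [hpp, hφp]
    rw [← e1] at d3
    have d4 := HasFDerivAt.comp c d3 d2
    have d5 := HasFDerivAt.comp (f := fun y => φ ((chartAt ℂ p).symm y)) (chartAt ℂ p p)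
      (by simp only [e2]; exact d4) d1
    refine posJacobianAt_of_hasFDerivAt h.continuous.continuousAt
      (d5.congr_of_eventuallyEq ?_) ?_
    · have e3 : ∀ᶠ y in nhds (chartAt ℂ p p), (chartAt ℂ p).symm y ∈ φ.source := by
        refine ((chartAt ℂ p).continuousAt_symm hcp) (φ.open_source.mem_nhds ?_)
        rw [hpp]
        exact hps
      filter_upwards [e3] with y hy
      rw [hh _ hy]
      rfl
    · rw [ContinuousLinearMap.comp_id]
      exact (mul_pos (det_smul_one_pos hw') (det_smul_one_pos hw)).trans_eq
        (LinearMap.det_comp _ _).symm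

/-- The relation is transitive, and nearby points can be pushed to each other in both directions;
connectedness does the rest. -/
theorem pushesTo [T2Space C] [ConnectedSpace C] [IsManifold 𝓘(ℂ) ω C] (p q : C) :
    PushesTo p q := by
  refine PreconnectedSpace.induction₂' PushesTo (fun x => ?_) ⟨fun _ _ _ => PushesTo.trans⟩ p q
  set φ := chartAt ℂ x with hφ
  obtain ⟨ε, hε, hball⟩ := Metric.isOpen_iff.mp φ.open_target (φ x) (mem_chart_target ℂ x)
  have hx : φ.symm (φ x) = x := φ.left_inv (mem_chart_source ℂ x)
  have e1 : ∀ᶠ y in nhds x, y ∈ φ.source := φ.open_source.mem_nhds (mem_chart_source ℂ x)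
  -- With `R = ε/4` this is the bound `R/2` on the displacement, and the ball of radius `R` around
  -- `φ y` also stays within `ε` of `φ x`.
  have e2 : ∀ᶠ y in nhds x, φ y ∈ Metric.closedBall (φ x) (ε / 4 / 2) :=
    (φ.continuousAt (mem_chart_source ℂ x)) (Metric.closedBall_mem_nhds _ (by positivity))
  filter_upwards [e1, e2] with y hy hy'
  rw [mem_closedBall_iff_norm] at hy'
  constructor
  · have := pushesTo_of_closedBall (x₀ := x) (c := φ x) (a := φ y - φ x) (R := ε / 4)
      (by positivity) hy' ((Metric.closedBall_subset_ball (by linarith)).trans hball)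
    rwa [← hφ, add_sub_cancel, hx, φ.left_inv hy] at this
  · have := pushesTo_of_closedBall (x₀ := x) (c := φ y) (a := φ x - φ y) (R := ε / 4)
      (by positivity) (by rwa [norm_sub_rev])
      ((Metric.closedBall_subset_ball' (by rw [dist_eq_norm]; linarith)).trans hball)
    rwa [← hφ, add_sub_cancel, hx, φ.left_inv hy] at this

end Pushing

/-! ### Evaluation in the central extension `G_Σ → G` -/

section CentralExtension

variable {G : Type*} [Group G] {g' d : ℕ}

theorem comm_mul_central {H : Type*} [Group H] {x y z z' : H} (hz : ∀ u, z * u = u * z)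
    (hz' : ∀ u, z' * u = u * z') : comm (x * z) (y * z') = comm x y := by
  unfold comm
  calc x * z * (y * z') * (x * z)⁻¹ * (y * z')⁻¹
      = x * (z * (y * z')) * z⁻¹ * x⁻¹ * (z'⁻¹ * y⁻¹) := by group
    _ = x * y * (z' * x⁻¹) * z'⁻¹ * y⁻¹ := by rw [hz]; group
    _ = x * y * x⁻¹ * y⁻¹ := by rw [hz']; group

theorem ev_congr_central {H : Type*} [Group H] {u u' : HurwitzVector g' d H}
    (h : ∀ i, u (Sum.inl i) = u' (Sum.inl i))
    (h' : ∀ j, ∃ z, (∀ y, z * y = y * z) ∧ u (Sum.inr j) = u' (Sum.inr j) * z) : ev u = ev u' := by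
  unfold ev
  congr 2
  · simp only [h]
  · congr 1
    funext j
    obtain ⟨z, hz, e⟩ := h' (Sum.inl j)
    obtain ⟨z', hz', e'⟩ := h' (Sum.inr j)
    rw [e, e', comm_mul_central hz hz']

theorem ev_of_commGroup {H : Type*} [CommGroup H] (u : HurwitzVector g' d H) {c : H}
    (h : ∀ i, u (Sum.inl i) = c) : ev u = c ^ d := by
  have hc : ∀ x y : H, comm x y = 1 := fun x y => by
    unfold comm
    rw [mul_inv_cancel_comm, mul_inv_cancel]
  simp [ev, h, hc]

theorem RSigma_le_ker (S : ConjUnion G) : RSigma S ≤ (FreeGroup.lift (id : G → G)).ker := by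
  refine Subgroup.normalClosure_le_normal ?_
  rintro w (⟨x, r, hr, rfl⟩ | ⟨a, b, c, ha, h, rfl⟩)
  · have hr' : FreeGroup.lift (id : G → G) r = 1 := hr
    rw [SetLike.mem_coe, MonoidHom.mem_ker, map_comm, hr']
    simp [comm]
  · rw [SetLike.mem_coe, MonoidHom.mem_ker]
    simp [h]

/-- The projection `G_Σ → G`, `ĝ ↦ g`. -/
def GSigma.proj (S : ConjUnion G) : GSigma S →* G :=
  QuotientGroup.lift (RSigma S) (FreeGroup.lift (id : G → G)) (RSigma_le_ker S)

theorem GSigma.proj_hat (S : ConjUnion G) (a : G) : GSigma.proj S (hat S a) = a := by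
  simp [GSigma.proj, hat]

/-- This is what the relators `[F, R]` are for: the kernel `R / R_Σ` is central. -/
theorem GSigma.mul_comm_of_proj_eq_one {S : ConjUnion G} {z : GSigma S}
    (hz : GSigma.proj S z = 1) (x : GSigma S) : z * x = x * z := by
  induction z using QuotientGroup.induction_on with | H r =>
  induction x using QuotientGroup.induction_on with | H x =>
  have h : comm x r ∈ RSigma S := Subgroup.subset_normalClosure (Or.inl ⟨x, r, hz, rfl⟩)
  have h' : ((comm x r : FreeGroup G) : GSigma S) = 1 := (QuotientGroup.eq_one_iff _).mpr h
  rw [← QuotientGroup.mk_mul, ← QuotientGroup.mk_mul]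
  have e : x * r = comm x r * (r * x) := by unfold comm; group
  rw [e, QuotientGroup.mk_mul _ (comm x r), h', one_mul]

theorem GSigma.eq_mul_central {S : ConjUnion G} {x y : GSigma S}
    (h : GSigma.proj S x = GSigma.proj S y) :
    ∃ z, (∀ u, z * u = u * z) ∧ x = y * z :=
  ⟨y⁻¹ * x, GSigma.mul_comm_of_proj_eq_one (by simp [h]), by group⟩

/-- For `x = ĝ` this is a relator of `G_Σ`; a general `x` differs from such an element by a central
factor. -/
theorem GSigma.conj_hat {S : ConjUnion G} (x : GSigma S) {c : G} (hc : c ∈ S.carrier) :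
    x * hat S c * x⁻¹ = hat S (GSigma.proj S x * c * (GSigma.proj S x)⁻¹) := by
  set g := GSigma.proj S x with hg
  have h1 : hat S g * hat S c * (hat S g)⁻¹ = hat S (g * c * g⁻¹) := by
    have h : (FreeGroup.of (g * c * g⁻¹) * FreeGroup.of g * (FreeGroup.of c)⁻¹ *
        (FreeGroup.of g)⁻¹ : FreeGroup G) ∈ RSigma S :=
      Subgroup.subset_normalClosure
        (Or.inr ⟨_, g, c, S.conj_mem c hc g, by group, rfl⟩)
    have h' : hat S (g * c * g⁻¹) * hat S g * (hat S c)⁻¹ * (hat S g)⁻¹ = 1 :=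
      (QuotientGroup.eq_one_iff _).mpr h
    rw [mul_inv_eq_one, mul_inv_eq_iff_eq_mul] at h'
    rw [← h', mul_inv_cancel_right]
  obtain ⟨z, hz, e⟩ := GSigma.eq_mul_central (x := x) (y := hat S g) (by rw [GSigma.proj_hat])
  rw [← h1, e, mul_assoc (hat S g), hz, ← mul_assoc, mul_inv_rev]
  group

/-- The tautological lift of a Hurwitz vector, as a homomorphism of the free group. -/
def hatLift (S : ConjUnion G) (w : HurwitzVector g' d G) : FreeGroup (Index g' d) →* GSigma S :=
  FreeGroup.lift fun k => hat S (w k)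

theorem proj_hatLift (S : ConjUnion G) (w : HurwitzVector g' d G) (x : FreeGroup (Index g' d)) :
    GSigma.proj S (hatLift S w x) = FreeGroup.lift w x := by
  have h : (GSigma.proj S).comp (hatLift S w) = FreeGroup.lift w := by
    ext k
    simp [hatLift, GSigma.proj_hat]
  exact DFunLike.congr_fun h x

theorem hatLift_ev (S : ConjUnion G) (w : HurwitzVector g' d G) :
    hatLift S w (ev FreeGroup.of) = ev fun k => hat S (w k) := by
  rw [map_ev]
  simp [hatLift]

theorem hatLift_ev_central (S : ConjUnion G) {w : HurwitzVector g' d G} (hw : ev w = 1)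
    (x : GSigma S) :
    hatLift S w (ev FreeGroup.of) * x = x * hatLift S w (ev FreeGroup.of) := by
  refine GSigma.mul_comm_of_proj_eq_one ?_ x
  rw [proj_hatLift, map_ev]
  simpa using hw

/-- The images of the `Θ(γᵢ)` are conjugates of tautological lifts, so `GSigma.conj_hat` identifies
them with the lifts of the entries of `v`. The remaining entries lie over those of `v` and may be
off by central factors. -/
theorem ev_hat_eq_hatLift (S : ConjUnion G) {v w : HurwitzVector g' d G}
    (hw : ∀ i, w (Sum.inl i) ∈ S.carrier) (Θ : FreeGroup (Index g' d) →* FreeGroup (Index g' d))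
    (hΘ : ∀ k, FreeGroup.lift w (Θ (FreeGroup.of k)) = v k) (σ : Fin d → Fin d)
    (hσ : ∀ i, IsConj (FreeGroup.of (Sum.inl (σ i) : Index g' d)) (Θ (FreeGroup.of (Sum.inl i)))) :
    (ev fun k => hat S (v k)) = hatLift S w (Θ (ev FreeGroup.of)) := by
  rw [map_ev, map_ev]
  refine ev_congr_central (fun i => ?_) fun j => GSigma.eq_mul_central ?_
  · obtain ⟨u, hu⟩ := isConj_iff.mp (hσ i)
    rw [← hΘ, ← hu]
    simp only [map_mul, map_inv, hatLift, FreeGroup.lift_apply_of]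
    rw [← hatLift, GSigma.conj_hat _ (hw _), proj_hatLift]
  · rw [GSigma.proj_hat, proj_hatLift, hΘ]

/-- A transformation of the free group which lifts the passage from `v` to `w` and does not change
the evaluation of the tautological lift preserves `ε`. -/
theorem epsilon_eq_of_lift {v w : HS G g' d}
    (Θ : FreeGroup (Index g' d) →* FreeGroup (Index g' d))
    (hΘ : ∀ k, FreeGroup.lift w.vec (Θ (FreeGroup.of k)) = v.vec k) (σ : Fin d → Fin d)
    (hσs : Function.Surjective σ)
    (hσ : ∀ i, IsConj (FreeGroup.of (Sum.inl (σ i) : Index g' d)) (Θ (FreeGroup.of (Sum.inl i))))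
    (h : hatLift w.sigma w.vec (Θ (ev FreeGroup.of)) = hatLift w.sigma w.vec (ev FreeGroup.of)) :
    epsilon v = epsilon w := by
  have hconj : ∀ i, IsConj (w.vec (Sum.inl (σ i))) (v.vec (Sum.inl i)) := fun i => by
    have := (FreeGroup.lift w.vec).map_isConj (hσ i)
    rwa [FreeGroup.lift_apply_of, hΘ] at this
  have hS : v.sigma = w.sigma := by
    refine ConjUnion.ext (Set.ext fun a => ⟨?_, ?_⟩)
    · rintro ⟨i, hi⟩
      exact ⟨σ i, (hconj i).trans hi⟩
    · rintro ⟨i, hi⟩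
      obtain ⟨i, rfl⟩ := hσs i
      exact ⟨i, (hconj i).symm.trans hi⟩
  -- The group `G_Σ` depends on `Σ`, so the equality of the two unions is used by substituting for a
  -- variable `T`.
  have key : ∀ T : ConjUnion G, T = w.sigma →
      (⟨T, ev fun k => hat T (v.vec k)⟩ : GUnion G) = epsilon w := by
    rintro _ rfl
    have e := ev_hat_eq_hatLift w.sigma (v := v.vec) (fun i => ⟨i, IsConj.refl _⟩) Θ hΘ σ hσ
    rw [h, hatLift_ev] at e
    exact congrArg (Sigma.mk w.sigma) e
  exact key _ hS

theorem hatLift_ev_eq_of_isConj (S : ConjUnion G) {w : HurwitzVector g' d G} (hw : ev w = 1)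
    {x : FreeGroup (Index g' d)} (hx : IsConj (ev FreeGroup.of) x) :
    hatLift S w x = hatLift S w (ev FreeGroup.of) := by
  obtain ⟨u, rfl⟩ := isConj_iff.mp hx
  rw [map_mul, map_mul, ← hatLift_ev_central S hw, map_inv, mul_inv_cancel_right]

/-- `Θ` preserves the exponent sum of the `γᵢ` in the relation. Hence, if there are any `γᵢ`, the
image of the relation under `Θ` cannot be congruent to another power of it. -/
theorem hatLift_ev_eq_of_mem_normalClosure (S : ConjUnion G) {w : HurwitzVector g' d G}
    (hw : ev w = 1) (hd : d ≠ 0) (Θ : FreeGroup (Index g' d) →* FreeGroup (Index g' d))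
    (σ : Fin d → Fin d)
    (hσ : ∀ i, IsConj (FreeGroup.of (Sum.inl (σ i) : Index g' d)) (Θ (FreeGroup.of (Sum.inl i))))
    (h : Θ (ev FreeGroup.of) ∈ Subgroup.normalClosure {ev (FreeGroup.of : Index g' d → _)}) :
    hatLift S w (Θ (ev FreeGroup.of)) = hatLift S w (ev FreeGroup.of) := by
  let ψ : FreeGroup (Index g' d) →* Multiplicative ℤ :=
    FreeGroup.lift (Sum.elim (fun _ => Multiplicative.ofAdd 1) fun _ => 1)
  have hψ : ψ (ev FreeGroup.of) = Multiplicative.ofAdd (d : ℤ) := by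
    rw [map_ev, ev_of_commGroup _ (c := Multiplicative.ofAdd 1) (fun i => by simp [ψ]),
      ← ofAdd_nsmul]
    simp
  have hψ' : ψ (Θ (ev FreeGroup.of)) = Multiplicative.ofAdd (d : ℤ) := by
    rw [map_ev, map_ev, ev_of_commGroup _ (c := Multiplicative.ofAdd 1), ← ofAdd_nsmul]
    · simp
    · intro i
      rw [← isConj_iff_eq.mp (ψ.map_isConj (hσ i))]
      simp [ψ]
  -- Pairing with the exponent sum makes the same power `k` occur in both components. The image of
  -- the relation is central, so its powers form a normal subgroup that contains the image of the
  -- normal closure.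
  let χ := (hatLift S w).prod ψ
  have hcentral : Subgroup.zpowers (χ (ev FreeGroup.of)) ≤ Subgroup.center _ := by
    rw [Subgroup.zpowers_le, Subgroup.mem_center_iff]
    rintro ⟨x, n⟩
    exact Prod.ext (hatLift_ev_central S hw x).symm (mul_comm _ _)
  have hn : (Subgroup.zpowers (χ (ev FreeGroup.of))).Normal := ⟨fun n hn g => by
    rwa [Subgroup.mem_center_iff.mp (hcentral hn) g, mul_inv_cancel_right]⟩
  have hle : Subgroup.normalClosure {ev (FreeGroup.of : Index g' d → _)} ≤
      (Subgroup.zpowers (χ (ev FreeGroup.of))).comap χ := by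
    refine Subgroup.normalClosure_le_normal ?_
    rintro _ rfl
    exact Subgroup.mem_zpowers _
  obtain ⟨k, hk⟩ := Subgroup.mem_zpowers_iff.mp (hle h)
  have hk1 : hatLift S w (ev FreeGroup.of) ^ k = hatLift S w (Θ (ev FreeGroup.of)) :=
    congrArg Prod.fst hk
  have hk2 : ψ (ev FreeGroup.of) ^ k = ψ (Θ (ev FreeGroup.of)) := congrArg Prod.snd hk
  rw [hψ, hψ', ← ofAdd_zsmul, Multiplicative.ofAdd.injective.eq_iff, smul_eq_mul] at hk2
  have : k = 1 := mul_right_cancel₀ (by exact_mod_cast hd) (hk2.trans (one_mul _).symm)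
  rw [← hk1, this, zpow_one]

end CentralExtension

/-! ### The action of diffeomorphisms -/

section Action

variable {C : Type*} [TopologicalSpace C] [ChartedSpace ℂ C]

theorem IsLoopAround.map_fillIn {B : Set C} {p q : C} {y : C} {hy : y ∉ insert p B}
    {x : FundamentalGroup (Punctured (insert p B)) ⟨y, hy⟩} (hx : IsLoopAround q x) (hq : q ∈ B) :
    IsLoopAround q (FundamentalGroup.map (fillIn B p) ⟨y, hy⟩ x) := by
  obtain ⟨-, r, hr, hs, hB, s, circle, l, hc, rfl⟩ := hx
  refine ⟨hq, r, hr, hs, fun z hz hzB => hB z hz (Set.mem_insert_of_mem _ hzB), fillIn B p s,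
    circle.map (fillIn B p).continuous, l.map (fillIn B p).continuous, hc, ?_⟩
  have e : ((l.trans circle).trans l.symm).map (fillIn B p).continuous =
      ((l.map (fillIn B p).continuous).trans (circle.map (fillIn B p).continuous)).trans
        (l.map (fillIn B p).continuous).symm := by
    rw [Path.map_trans, Path.map_trans, Path.map_symm]
  exact congrArg (fun c => FundamentalGroup.fromPath (Path.Homotopic.Quotient.mk c)) e

theorem DiffPlus.posJacobianAt {B : Set C} (f : DiffPlus B) (p : C) :
    PosJacobianAt (f : C ≃ₜ C) p :=
  ⟨f.2.1.mdifferentiable (by simp) p, f.2.2.2.1 p⟩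

variable {g' d : ℕ} {B : Set C} {y₀ : Punctured B} {G : Type*} [Group G]

namespace GeometricBasis

variable (b : GeometricBasis g' d B y₀)

theorem monodromy_lift (v : HS G g' d) (x : FreeGroup (Index g' d)) :
    b.monodromy v (FreeGroup.lift b.gen x) = FreeGroup.lift v.vec x := by
  have h : (b.monodromy v).comp (FreeGroup.lift b.gen) = FreeGroup.lift v.vec := by
    ext k
    simp [monodromy_gen]
  exact DFunLike.congr_fun h x

theorem isLoopAround_gen (i : Fin d) : IsLoopAround (b.pt i) (b.gen (Sum.inl i)) := by
  rw [b.gen_eq]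
  exact (b.around i).map_fillIn (b.range_pt.le ⟨i, rfl⟩)

/-- An endomorphism of `π₁(C ∖ B)` which permutes the conjugacy classes of the `γᵢ` lifts to the
free group on the geometric basis. -/
theorem exists_lift {φ : FundamentalGroup (Punctured B) y₀ →* FundamentalGroup (Punctured B) y₀}
    {σ : Fin d → Fin d}
    (hφ : ∀ i, IsConj (b.gen (Sum.inl (σ i))) (φ (b.gen (Sum.inl i)))) :
    ∃ Θ : FreeGroup (Index g' d) →* FreeGroup (Index g' d),
      (∀ x, FreeGroup.lift b.gen (Θ x) = φ (FreeGroup.lift b.gen x)) ∧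
      ∀ i, IsConj (FreeGroup.of (Sum.inl (σ i) : Index g' d)) (Θ (FreeGroup.of (Sum.inl i))) := by
  have h1 : ∀ i, ∃ u, FreeGroup.lift b.gen u = φ (b.gen (Sum.inl i)) ∧
      IsConj (FreeGroup.of (Sum.inl (σ i) : Index g' d)) u := by
    intro i
    obtain ⟨c, hc⟩ := isConj_iff.mp (hφ i)
    obtain ⟨c, rfl⟩ := b.gen_surjective c
    -- Lifting the conjugating element, rather than the image of `γᵢ`, makes the conjugacy hold
    -- already in the free group.
    exact ⟨c * FreeGroup.of (Sum.inl (σ i)) * c⁻¹, by simpa using hc, isConj_iff.mpr ⟨c, rfl⟩⟩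
  have h2 : ∀ j, ∃ u, FreeGroup.lift b.gen u = φ (b.gen (Sum.inr j)) :=
    fun j => b.gen_surjective _
  choose u hu hu' using h1
  choose t ht using h2
  refine ⟨FreeGroup.lift (Sum.elim u t), fun x => ?_, fun i => by simpa using hu' i⟩
  have h : (FreeGroup.lift b.gen).comp (FreeGroup.lift (Sum.elim u t)) =
      φ.comp (FreeGroup.lift b.gen) := by
    ext k
    rcases k with i | j
    · simp [hu]
    · simp [ht]
  exact DFunLike.congr_fun h x

/-- With branch points, the algebra of the relation suffices once the classes of the `γᵢ` are known
to be permuted. -/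
theorem epsilon_eq_of_transforms (hd : d ≠ 0) {f : DiffPlus B} {v w : HS G g' d}
    (h : b.Transforms f v w) : epsilon v = epsilon w := by
  obtain ⟨l, hl⟩ := h
  have hB : ∀ p, p ∈ B ↔ ∃ i, b.pt i = p := fun p =>
    ⟨fun h => b.range_pt.ge h, fun h => b.range_pt.le h⟩
  have hσ : ∀ i, ∃ j, b.pt j = (f : C ≃ₜ C) (b.pt i) := fun i =>
    (hB _).mp ((f.2.2.2.2 _).mpr ((hB _).mpr ⟨i, rfl⟩))
  choose σ hσ using hσ
  have hσs : Function.Surjective σ := by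
    intro j
    obtain ⟨i, hi⟩ := (hB _).mp ((f⁻¹).2.2.2.2 (b.pt j) |>.mpr ((hB _).mpr ⟨j, rfl⟩))
    refine ⟨i, b.pt_injective ?_⟩
    rw [hσ, hi]
    exact (f : C ≃ₜ C).apply_symm_apply _
  let φ : FundamentalGroup (Punctured B) y₀ →* FundamentalGroup (Punctured B) y₀ :=
    (alongPath l).toMonoidHom.comp (FundamentalGroup.map (DiffPlus.punctured f) y₀)
  have hφ : ∀ i, IsConj (b.gen (Sum.inl (σ i))) (φ (b.gen (Sum.inl i))) := by
    intro i
    obtain ⟨g, hg, hg'⟩ := exists_represents_map (DiffPlus.posJacobianAt f (b.pt i))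
      (DiffPlus.punctured f) (fun _ => rfl) (b.isLoopAround_gen i)
      (by rw [← hσ]; exact b.isLoopAround_gen (σ i))
    exact hg'.isConj (hg.alongPath l)
  obtain ⟨Θ, hΘ, hΘσ⟩ := b.exists_lift hφ
  have hμ : ∀ x, b.monodromy w (φ x) = b.monodromy v x := hl
  refine epsilon_eq_of_lift Θ (fun k => ?_) σ hσs hΘσ
    (hatLift_ev_eq_of_mem_normalClosure _ w.ev_eq_one hd Θ σ hΘσ ?_)
  · rw [← b.monodromy_lift, hΘ, hμ, b.monodromy_lift, FreeGroup.lift_apply_of]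
  -- The relation dies in `π₁(C ∖ B)`, hence so does its image under `Θ`, and the kernel is the
  -- normal closure of the relation.
  · have hr : FreeGroup.lift b.gen (ev FreeGroup.of) = 1 := by
      rw [← MonoidHom.mem_ker, b.gen_ker]
      exact Subgroup.subset_normalClosure rfl
    rw [← b.gen_ker, MonoidHom.mem_ker, hΘ, hr, map_one]

end GeometricBasis

end Action

/-! ### Surfaces without branch points -/

section Closed

section

variable {C : Type*} [TopologicalSpace C]

/-- The map of `C ∖ ∅` to itself given by a map of `C` to itself. -/
def puncturedEmpty (f : C(C, C)) : C(Punctured (∅ : Set C), Punctured (∅ : Set C)) where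
  toFun x := ⟨f x, Set.notMem_empty _⟩
  continuous_toFun := (f.continuous.comp continuous_subtype_val).subtype_mk _

theorem puncturedEmpty_homotopic {f h : C(C, C)} (H : f.Homotopic h) :
    (puncturedEmpty f).Homotopic (puncturedEmpty h) := by
  let i : C(Punctured (∅ : Set C), C) := ⟨Subtype.val, continuous_subtype_val⟩
  let j : C(C, Punctured (∅ : Set C)) :=
    ⟨fun x => ⟨x, Set.notMem_empty _⟩, continuous_id.subtype_mk _⟩
  exact ((ContinuousMap.Homotopic.refl j).comp H).comp (ContinuousMap.Homotopic.refl i)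

end

variable {C : Type*} [TopologicalSpace C] [T2Space C] [ConnectedSpace C] [ChartedSpace ℂ C]
  [IsManifold 𝓘(ℂ) ω C] {g' : ℕ} {y₀ : Punctured (∅ : Set C)} {G : Type*} [Group G]

/-- Without branch points, a diffeomorphism is homotopic to a map which fixes the centre of the
polygon and acts on the complement of the centre. -/
theorem GeometricBasis.epsilon_smul_eq_of_transforms (b : GeometricBasis g' 0 (∅ : Set C) y₀)
    {f : DiffPlus (∅ : Set C)} {v w : HS G g' 0} (H : b.Transforms f v w) :
    ∃ c : MulAut G, epsilon (c • v) = epsilon w := by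
  obtain ⟨l, hl⟩ := H
  obtain ⟨h, hh, hp, hinj, hpos⟩ := pushesTo ((f : C ≃ₜ C) b.centre) b.centre
  let f' : C(C, C) := ⟨(f : C ≃ₜ C), (f : C ≃ₜ C).continuous⟩
  let F : C(C, C) := h.comp f'
  have hFp : F b.centre = b.centre := hp
  have hF : F.Homotopic f' := by
    simpa using hh.comp (ContinuousMap.Homotopic.refl f')
  have hFpos : PosJacobianAt F b.centre := 
    PosJacobianAt.comp (f := f') (h := h) hpos (DiffPlus.posJacobianAt f _)
  have hFm : ∀ x : Punctured (insert b.centre (∅ : Set C)), F x ∉ insert b.centre (∅ : Set C) := by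
    intro x hx
    have hx' : F x = b.centre := by simpa using hx
    exact x.2 (Or.inl ((f : C ≃ₜ C).injective (hinj _ hx')))
  let Fp : C(Punctured (insert b.centre (∅ : Set C)), Punctured (insert b.centre (∅ : Set C))) :=
    ⟨fun x => ⟨F x, hFm x⟩, (F.continuous.comp continuous_subtype_val).subtype_mk hFm⟩
  set y₁ : Punctured (insert b.centre (∅ : Set C)) := ⟨y₀, b.base_notMem⟩
  have hrep : ∀ {x : FundamentalGroup _ y₁}, IsLoopAround b.centre x →
      ∃ m : Path y₁ (Fp y₁), IsConj x (alongPath m (FundamentalGroup.map Fp y₁ x)) := by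
    intro x hx
    obtain ⟨g, hg, hg'⟩ := exists_represents_map hFpos Fp (fun _ => rfl) hx (by rw [hFp]; exact hx)
    obtain ⟨m⟩ := hg'.joined hg
    exact ⟨m, hg'.isConj (hg.alongPath m)⟩
  -- The direction of the boundary loop is unspecified; if its inverse is the positive loop, the
  -- conjugacy is inverted.
  obtain ⟨m, hm⟩ : ∃ m : Path y₁ (Fp y₁),
      IsConj (ev b.loop) (alongPath m (FundamentalGroup.map Fp y₁ (ev b.loop))) := by
    rcases b.boundary with hb | hb
    · exact hrep hb
    · obtain ⟨m, hm⟩ := hrep hb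
      rw [map_inv, map_inv] at hm
      obtain ⟨c, hc⟩ := isConj_iff.mp hm
      refine ⟨m, isConj_iff.mpr ⟨c, ?_⟩⟩
      rw [← inv_inj, ← hc]
      group
  let Φ := (alongPath m).toMonoidHom.comp (FundamentalGroup.map Fp y₁)
  let ι : FundamentalGroup _ y₁ →* FundamentalGroup (Punctured (∅ : Set C)) y₀ :=
    FundamentalGroup.map (fillIn ∅ b.centre) y₁
  -- `n` is the track of `y₀` under the deformation of `F` into `f`. Both `m₀` followed by `n` and
  -- the given `l` run from `y₀` to `f y₀`, and `δ` measures their difference.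
  obtain ⟨n, hn⟩ := exists_map_eq_alongPath (puncturedEmpty_homotopic hF) y₀
  let m₀ : Path y₀ (puncturedEmpty F y₀) := m.map (fillIn ∅ b.centre).continuous
  obtain ⟨δ, hδ⟩ := alongPath_conj (m₀.trans n) l
  have hΦ : ∀ z, ι (Φ z) =
      δ * alongPath l (FundamentalGroup.map (DiffPlus.punctured f) y₀ (ι z)) * δ⁻¹ := by
    intro z
    have e1 : ι (Φ z) = alongPath m₀
        (FundamentalGroup.map (puncturedEmpty F) y₀ (ι z)) := by
      have e2 := map_alongPath (fillIn ∅ b.centre) m (FundamentalGroup.map Fp y₁ z)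
      rw [← fundamentalGroup_map_comp] at e2
      refine e2.trans ?_
      have e3 := fundamentalGroup_map_comp (puncturedEmpty F) (fillIn ∅ b.centre) y₁ z
      exact congrArg _ e3
    rw [e1, hn, ← alongPath_trans]
    exact hδ _
  refine ⟨MulAut.conj (b.monodromy w δ), ?_⟩
  let e := MulEquiv.ofBijective (FreeGroup.lift b.loop) b.free
  -- No lift has to be chosen: the free group is the fundamental group of the complement of the
  -- centre, and `Θ` is the action of `F` on it.
  let Θ : FreeGroup (Index g' 0) →* FreeGroup (Index g' 0) :=
    e.symm.toMonoidHom.comp (Φ.comp e.toMonoidHom)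
  have hι : ∀ x, FreeGroup.lift b.gen x = ι (e x) := by
    intro x
    have : FreeGroup.lift b.gen = ι.comp (FreeGroup.lift b.loop) := by
      ext k
      rw [MonoidHom.comp_apply, FreeGroup.lift_apply_of, FreeGroup.lift_apply_of]
      exact b.gen_eq k
    exact DFunLike.congr_fun this x
  have heΘ : ∀ x, e (Θ x) = Φ (e x) := fun x => e.apply_symm_apply _
  refine epsilon_eq_of_lift Θ (fun k => ?_) id Function.surjective_id (fun i => i.elim0)
    (hatLift_ev_eq_of_isConj _ w.ev_eq_one ?_)
  · rw [← b.monodromy_lift, hι, heΘ, hΦ, map_mul, map_mul, map_inv, hl, ← hι,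
      FreeGroup.lift_apply_of, b.monodromy_gen]
    rfl
  · have hev : e (ev FreeGroup.of) = ev b.loop := by
      change FreeGroup.lift b.loop _ = _
      rw [map_ev]
      simp
    have := e.symm.toMonoidHom.map_isConj hm
    have e4 : e.symm.toMonoidHom (ev b.loop) = ev FreeGroup.of := by
      rw [← hev]
      exact e.symm_apply_apply _
    rw [e4] at this
    change IsConj _ (e.symm (Φ (e (ev FreeGroup.of))))
    rw [hev]
    exact this

end Closed

theorem epsilonTilde_mk {G : Type*} [Group G] {g' d : ℕ} {v w : HS G g' d} (c : MulAut G)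
    (h : epsilon (c • v) = epsilon w) :
    epsilonTilde (Quotient.mk _ v : HSModAut G g' d) = epsilonTilde (Quotient.mk _ w) := by
  have e : (Quotient.mk _ v : HSModAut G g' d) = Quotient.mk _ (c • v) :=
    Quotient.sound ⟨c⁻¹, inv_smul_smul c v⟩
  rw [e]
  exact congrArg (Quotient.mk _) h

theorem GeometricBasis.epsilonTilde_eq_of_acts {C : Type*} [TopologicalSpace C] [T2Space C]
    [CompactSpace C] [ConnectedSpace C] [ChartedSpace ℂ C] [IsManifold 𝓘(ℂ) ω C] {G : Type*}
    [Group G] {g' d : ℕ} {B : Set C} {y₀ : Punctured B} (b : GeometricBasis g' d B y₀)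
    {φ : MappingClassGroup B} {X Y : HSModAut G g' d} (h : b.Acts φ X Y) :
    epsilonTilde X = epsilonTilde Y := by
  obtain ⟨f, -, v, w, rfl, rfl, hf⟩ := h
  -- Counting the `γᵢ` determines the power of the relation only if there are any.
  rcases eq_or_ne d 0 with rfl | hd
  · obtain rfl : B = ∅ := b.range_pt.symm.trans (Set.range_eq_empty _)
    obtain ⟨c, hc⟩ := b.epsilon_smul_eq_of_transforms hf
    exact epsilonTilde_mk c hc
  · exact epsilonTilde_mk 1 (by rw [one_smul]; exact b.epsilon_eq_of_transforms hd hf)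

end Hurwitz

end

theorem proposition3p7 (G : Type*) [Group G] [Finite G] (g' d : ℕ)
    {C : Type*} [TopologicalSpace C] [T2Space C] [CompactSpace C] [ConnectedSpace C]
    [ChartedSpace ℂ C] [IsManifold 𝓘(ℂ) ω C]
    (B : Set C) (y₀ : Hurwitz.Punctured B) (b : Hurwitz.GeometricBasis g' d B y₀) :
    (∀ (φ : Hurwitz.MappingClassGroup B) (X Y : Hurwitz.HSModAut G g' d),
      b.Acts φ X Y → Hurwitz.epsilonTilde X = Hurwitz.epsilonTilde Y) ∧
    ∃! εhat : b.UnmarkedTypes G → Hurwitz.GUnionModAut G,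
      ∀ X : Hurwitz.HSModAut G g' d, εhat (b.unmarkedType X) = Hurwitz.epsilonTilde X := by
  refine ⟨fun φ X Y h => b.epsilonTilde_eq_of_acts h,
    Quot.lift Hurwitz.epsilonTilde fun X Y ⟨φ, h⟩ => b.epsilonTilde_eq_of_acts h,
    fun X => rfl, fun ε hε => ?_⟩
  funext X
  induction X using Quot.ind with | mk X => exact hε X
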